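/- **Setting.** Let $\mathbb{D}$ be the open unit disc, $\mathbb{T}$ the unit circle, and $m=|\cdot|$ normalized Lebesgue measure (Haar probability measure) on $\mathbb{T}$ and on $\mathbb{T}^2$. For a function $f:\mathbb{D}^2\to\mathbb{C}$ put $$\|f\|_p^p=\sup_{0<r<1}\int_{\mathbb{T}^2}|f(r\zeta)|^p\,dm(\zeta).$$ $H^p(\mathbb{D}^2)$ is the space of holomorphic $f$ on $\mathbb{D}^2$ with $\|f\|_p<\infty$, and $h^p(\mathbb{D}^2)$ is the space of complex-valued $u\in C^\infty(\mathbb{D}^2)$ that are harmonic in each variable separately and satisfy $\|u\|_p<\infty$. A positive Borel measure $\mu$ on $\mathbb{D}^2$ is Carleson for $H^p(\mathbb{D}^2)$ (respectively for $h^p(\mathbb{D}^2)$) if $H^p(\mathbb{D}^2)\subseteq L^p(\mathbb{D}^2,\mu)$ (respectively $h^p(\mathbb{D}^2)\subseteq L^p(\mathbb{D}^2,\mu)$). For an arc $I\subseteq\mathbb{T}$ let $S(I)=\{z\in\mathbb{D}\setminus\{0\}: 1-|z|\le |I|,\ z/|z|\in I\}$, and for an open set $U\subseteq\mathbb{T}^2$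 let $S(U)$ be the union of $S(I_1)\times S(I_2)$ over all pairs of arcs $I_1,I_2\subseteq\mathbb{T}$ with $I_1\times I_2\subseteq U$. The measure $\mu$ satisfies the Chang–Stein condition if there is a constant $C>0$ such that $\mu(S(U))\le C\,|U|$ for every open $U\subseteq\mathbb{T}^2$. **Lemma.** Let $1<p<\infty$, let $\mu$ be a positive Borel measure on $\mathbb{D}^2$, and let $\sigma_*\mu$ be its push-forward under $\sigma(z_1,z_2)=(\overline{z_1},z_2)$. If both $\mu$ and $\sigma_*\mu$ are Carleson for $H^p(\mathbb{D}^2)$, then $\mu$ is Carleson for $h^p(\mathbb{D}^2)$, and $\mu$ satisfies the Chang–Stein condition. -/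

import Mathlib

open MeasureTheory InnerProductSpace
open scoped ENNReal

namespace BidiscHardy

noncomputable section

/-- The open unit disc, as a type with its Borel sigma-algebra. -/
abbrev Disc : Type := Metric.ball (0 : ℂ) 1

/-- The open unit bidisc, as a subset of `ℂ × ℂ`. -/
def bidisc : Set (ℂ × ℂ) := Metric.ball (0 : ℂ) 1 ×ˢ Metric.ball (0 : ℂ) 1

/-- The torus, parametrized as `(ℝ/ℤ)²`. Its `volume` is the Haar probability measure. -/
abbrev Torus : Type := UnitAddCircle × UnitAddCircle

/-- The point `exp (2 π i t)` of the unit circle. -/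
def circlePt (t : UnitAddCircle) : ℂ := (AddCircle.toCircle t : ℂ)

/-- `‖f‖_p ^ p`, the supremum over `0 < r < 1` of the integrals of `|f (r ζ)| ^ p` over the
torus. -/
def hardyNormPow (p : ℝ) (f : ℂ × ℂ → ℂ) : ℝ≥0∞ :=
  ⨆ r ∈ Set.Ioo (0 : ℝ) 1,
    ∫⁻ t : Torus, ‖f ((r : ℂ) * circlePt t.1, (r : ℂ) * circlePt t.2)‖ₑ ^ p

/-- `f` (restricted to the bidisc) belongs to the holomorphic Hardy space `H^p`. -/
def MemHolHardy (p : ℝ) (f : ℂ × ℂ → ℂ) : Prop :=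
  DifferentiableOn ℂ f bidisc ∧ hardyNormPow p f < ∞

/-- `u` (restricted to the bidisc) belongs to the Hardy space `h^p` of smooth complex-valued
separately harmonic functions. -/
def MemHarmHardy (p : ℝ) (u : ℂ × ℂ → ℂ) : Prop :=
  ContDiffOn ℝ (⊤ : ℕ∞) u bidisc ∧
  (∀ w ∈ Metric.ball (0 : ℂ) 1, HarmonicOnNhd (fun z : ℂ => u (z, w)) (Metric.ball 0 1)) ∧
  (∀ z ∈ Metric.ball (0 : ℂ) 1, HarmonicOnNhd (fun w : ℂ => u (z, w)) (Metric.ball 0 1)) ∧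
  hardyNormPow p u < ∞

/-- Membership in `L^p(μ)` of the restriction of `f` to the bidisc. -/
def MemLpBidisc (p : ℝ) (μ : Measure (Disc × Disc)) (f : ℂ × ℂ → ℂ) : Prop :=
  MemLp (fun z : Disc × Disc => f ((z.1 : ℂ), (z.2 : ℂ))) (ENNReal.ofReal p) μ

/-- `μ` is Carleson for `H^p`: the holomorphic Hardy space is contained in `L^p(μ)`. -/
def IsHolCarleson (p : ℝ) (μ : Measure (Disc × Disc)) : Prop :=
  ∀ f : ℂ × ℂ → ℂ, MemHolHardy p f → MemLpBidisc p μ f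

/-- `μ` is Carleson for `h^p`: the separately harmonic Hardy space is contained in `L^p(μ)`. -/
def IsHarmCarleson (p : ℝ) (μ : Measure (Disc × Disc)) : Prop :=
  ∀ u : ℂ × ℂ → ℂ, MemHarmHardy p u → MemLpBidisc p μ u

/-- Complex conjugation on the unit disc. -/
def conjDisc (z : Disc) : Disc :=
  ⟨(starRingEnd ℂ) z, by
    have h := z.2
    rw [mem_ball_zero_iff] at h ⊢
    rwa [RCLike.norm_conj]⟩

/-- The map `(z₁, z₂) ↦ (conj z₁, z₂)` of the bidisc. -/
def sigma (z : Disc × Disc) : Disc × Disc := (conjDisc z.1, z.2)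

theorem measurable_sigma : Measurable sigma := by
  have h : Continuous conjDisc :=
    Continuous.subtype_mk (RCLike.continuous_conj.comp continuous_subtype_val) _
  exact (h.comp continuous_fst).measurable.prodMk measurable_snd

/-- An arc of the circle (open, closed or half-open, the full circle and the degenerate ones
included): the image of an interval of the line. -/
def IsArc (I : Set UnitAddCircle) : Prop :=
  ∃ J : Set ℝ, J.OrdConnected ∧ I = (fun x : ℝ => (x : UnitAddCircle)) '' J

/-- The region `S(I)` of all `z ≠ 0` in the disc with `1 - |z| ≤ |I|` and `z / |z| ∈ I`. -/
def carlesonRegion (I : Set UnitAddCircle) : Set Disc :=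
  {z | (z : ℂ) ≠ 0 ∧ ENNReal.ofReal (1 - ‖(z : ℂ)‖) ≤ volume I ∧
    (z : ℂ) / (‖(z : ℂ)‖ : ℂ) ∈ circlePt '' I}

/-- The region `S(U)`, the union of the boxes `S(I₁) × S(I₂)` over all rectangles
`I₁ × I₂ ⊆ U`. -/
def carlesonTent (U : Set Torus) : Set (Disc × Disc) :=
  {z | ∃ I₁ I₂ : Set UnitAddCircle, IsArc I₁ ∧ IsArc I₂ ∧ I₁ ×ˢ I₂ ⊆ U ∧
    z ∈ carlesonRegion I₁ ×ˢ carlesonRegion I₂}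

/-- The Chang–Stein condition: `μ (S(U)) ≤ C |U|` for all open subsets `U` of the torus, with a
finite constant `C`. -/
def ChangStein (μ : Measure (Disc × Disc)) : Prop :=
  ∃ C : ℝ, 0 < C ∧ ∀ U : Set Torus, IsOpen U →
    μ (carlesonTent U) ≤ ENNReal.ofReal C * volume U

end

end BidiscHardy

/-!
The proof rests on one kernel, the half Herglotz kernel `h (z, ζ) = (ζ + z) / (2 (ζ - z))`. It is
holomorphic in `z`, and `h + conj h` is the Poisson kernel. Expanding the product
`(h₁ + conj h₁) (h₂ + conj h₂)` writes the Poisson integral of a function on the torus as a sum of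
four terms (`biPoisson_eq`). Two are a holomorphic function of `(z₁, z₂)` and the conjugate of such
a function; the other two are of the same kind in `(conj z₁, z₂)`. If the boundary function is in
`L ^ p`, all four holomorphic functions are in `H ^ p`, by M. Riesz's theorem applied in each
variable, so that the Carleson conditions on `μ` and on `σ_* μ` put the Poisson integral
into `L ^ p (μ)` (`memLpBidisc_biPoisson`).

M. Riesz's theorem on the circle (`rieszInequality`) has a short proof for nonnegative `φ` and
`1 < p ≤ 2`. The transform `F` of `φ` has values in the right half plane, where
`|w| ^ p ≤ A (Re w) ^ p - B Re (w ^ p)`; the last term is harmonic and has nonnegative mean over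
circles, and `2 Re F` is the Poisson integral of `φ`. The exponents `p > 2` follow by duality.

A function `u ∈ h ^ p` is the Poisson integral of its restrictions to smaller tori. Since a harmonic
function of one variable is the sum of a holomorphic function and the conjugate of one, the
transforms of these restrictions do not depend, up to scaling, on the torus
(`IsSepHarmonic.biHerglotz_onTorus_congr`). They patch together to four functions in `H ^ p`, and
`μ` is Carleson for `h ^ p` (`isHarmCarleson`).

For the Chang–Stein condition (`changStein`), Poisson integrals of functions `≥ a` on `U` are
`≥ c a` on the tent over `U`. No closed graph theorem is needed: if the condition failed with
constants `4 ^ n` on sets `U n`, a single function in `L ^ p` built from the indicators of the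
`U n` would have its Poisson integral outside `L ^ p (μ)`.
-/

namespace BidiscHardy

noncomputable section

open Complex Metric Set Filter Topology ComplexConjugate

/-! ### The circle and the half Herglotz kernel -/

theorem continuous_circlePt : Continuous circlePt :=
  continuous_subtype_val.comp AddCircle.continuous_toCircle

@[simp] theorem norm_circlePt (t : UnitAddCircle) : ‖circlePt t‖ = 1 :=
  Circle.norm_coe _

theorem circlePt_ne_zero (t : UnitAddCircle) : circlePt t ≠ 0 :=
  Circle.coe_ne_zero _

@[simp] theorem circlePt_neg (t : UnitAddCircle) : circlePt (-t) = conj (circlePt t) := by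
  simp [circlePt, AddCircle.toCircle_neg, ← Circle.coe_inv_eq_conj]

theorem circlePt_coe (x : ℝ) : circlePt (x : UnitAddCircle) = exp (2 * Real.pi * x * I) := by
  simp [circlePt, AddCircle.toCircle_apply_mk]

theorem circlePt_mul_conj (t : UnitAddCircle) : circlePt t * conj (circlePt t) = 1 := by
  rw [Complex.mul_conj, Complex.normSq_eq_norm_sq]; simp

theorem norm_ofReal_mul_circlePt {r : ℝ} (hr : 0 ≤ r) (t : UnitAddCircle) :
    ‖(r : ℂ) * circlePt t‖ = r := by
  simp [abs_of_nonneg hr]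

/-- Integrals over `ℝ/ℤ` of functions of `r * exp (2πit)` are circle averages. -/
theorem integral_circlePt (f : ℂ → ℂ) (r : ℝ) :
    ∫ t, f (r * circlePt t) = Real.circleAverage f 0 r := by
  rw [Real.circleAverage_def, ← UnitAddCircle.intervalIntegral_preimage 0]
  have h := intervalIntegral.integral_comp_mul_left
    (a := 0) (b := 1) (fun θ : ℝ => f (circleMap 0 r θ)) (c := 2 * Real.pi) (by positivity)
  simp only [mul_zero, mul_one] at h
  rw [← h]
  simp only [zero_add]
  congr 1
  ext x
  rw [circlePt_coe, circleMap]
  push_cast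
  simp

/-- Half of the Herglotz kernel, `(ζ + z) / (2 (ζ - z))` at `ζ = exp (2πis)`. With this
normalization the Poisson kernel is `halfHerglotz + conj halfHerglotz`. -/
def halfHerglotz (z : ℂ) (s : UnitAddCircle) : ℂ :=
  (circlePt s + z) / (circlePt s - z) / 2

/-- The Poisson kernel `poissonKernel 0 z ζ` of the unit disc, at `ζ = exp (2πis)`. It has total
mass one for the normalized measure `ds`. -/
def poissonK (z : ℂ) (s : UnitAddCircle) : ℝ :=
  (1 - ‖z‖ ^ 2) / ‖circlePt s - z‖ ^ 2

theorem one_sub_norm_le (z : ℂ) (s : UnitAddCircle) : 1 - ‖z‖ ≤ ‖circlePt s - z‖ := by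
  have := norm_sub_norm_le (circlePt s) z
  simpa using this

theorem circlePt_sub_ne_zero {z : ℂ} (hz : ‖z‖ < 1) (s : UnitAddCircle) :
    circlePt s - z ≠ 0 := by
  rw [← norm_pos_iff]
  linarith [one_sub_norm_le z s]

theorem conj_halfHerglotz (z : ℂ) (s : UnitAddCircle) :
    conj (halfHerglotz z s) = halfHerglotz (conj z) (-s) := by
  simp [halfHerglotz, Complex.conj_ofNat]

/-- The integral operator with this kernel is, up to conjugation, its own transpose. -/
theorem conj_halfHerglotz_ofReal_mul {ρ : ℝ} (hρ : 0 ≤ ρ) (hρ1 : ρ < 1) (s t : UnitAddCircle) :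
    conj (halfHerglotz (ρ * circlePt t) s) = halfHerglotz (ρ * circlePt s) t := by
  have hs := circlePt_mul_conj s
  have ht := circlePt_mul_conj t
  have h1 := circlePt_sub_ne_zero (z := ρ * circlePt t)
    (by rwa [norm_ofReal_mul_circlePt hρ]) s
  have h2 := circlePt_sub_ne_zero (z := ρ * circlePt s)
    (by rwa [norm_ofReal_mul_circlePt hρ]) t
  have h3 : conj (circlePt s - ρ * circlePt t) ≠ 0 := (map_ne_zero _).2 h1
  simp only [halfHerglotz, map_div₀, map_add, map_sub, map_mul, conj_ofReal, map_ofNat] at *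
  congr 1
  rw [div_eq_div_iff h3 h2]
  linear_combination (2 * ρ : ℂ) * ht - 2 * ρ * hs

theorem two_mul_re_halfHerglotz (z : ℂ) (s : UnitAddCircle) :
    2 * (halfHerglotz z s).re = poissonK z s := by
  have h := congrFun (poissonKernel_eq_re_herglotzRieszKernel (c := 0) (w := z)) (circlePt s)
  simp only [poissonKernel_def, Function.comp_apply, herglotzRieszKernel_def, sub_zero,
    norm_circlePt, one_pow] at h
  rw [poissonK, h, halfHerglotz, ← ofReal_ofNat, div_ofReal_re]
  ring

theorem halfHerglotz_add_conj (z : ℂ) (s : UnitAddCircle) :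
    halfHerglotz z s + conj (halfHerglotz z s) = poissonK z s := by
  rw [add_conj, two_mul_re_halfHerglotz]

theorem norm_halfHerglotz_le {z : ℂ} (hz : ‖z‖ < 1) (s : UnitAddCircle) :
    ‖halfHerglotz z s‖ ≤ 1 / (1 - ‖z‖) := by
  have h1 := one_sub_norm_le z s
  have h2 : ‖circlePt s + z‖ ≤ 2 := (norm_add_le _ _).trans (by simp; linarith)
  have h3 : 0 < 1 - ‖z‖ := by linarith
  rw [halfHerglotz, norm_div, norm_div, Complex.norm_ofNat, div_div,
    div_le_div_iff₀ (by linarith) h3]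
  nlinarith

theorem hasDerivAt_halfHerglotz {z : ℂ} (hz : ‖z‖ < 1) (s : UnitAddCircle) :
    HasDerivAt (fun w => halfHerglotz w s) (circlePt s / (circlePt s - z) ^ 2) z := by
  have hne := circlePt_sub_ne_zero hz s
  have h := (((hasDerivAt_id z).const_add (circlePt s)).div
    ((hasDerivAt_id z).const_sub (circlePt s)) hne).div_const 2
  refine h.congr_deriv ?_
  simp only [id]
  field_simp
  ring

theorem norm_deriv_halfHerglotz_le {z : ℂ} (hz : ‖z‖ < 1) (s : UnitAddCircle) :
    ‖circlePt s / (circlePt s - z) ^ 2‖ ≤ 1 / (1 - ‖z‖) ^ 2 := by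
  have h1 := one_sub_norm_le z s
  have h3 : 0 < 1 - ‖z‖ := by linarith
  rw [norm_div, norm_pow, norm_circlePt]
  gcongr

@[fun_prop]
theorem measurable_circlePt : Measurable circlePt := continuous_circlePt.measurable

@[fun_prop]
theorem measurable_halfHerglotz : Measurable fun q : ℂ × UnitAddCircle => halfHerglotz q.1 q.2 := by
  unfold halfHerglotz
  fun_prop

theorem continuous_halfHerglotz {z : ℂ} (hz : ‖z‖ < 1) : Continuous (halfHerglotz z) := by
  unfold halfHerglotz
  have := continuous_circlePt
  exact ((this.add continuous_const).div (this.sub continuous_const)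
    (circlePt_sub_ne_zero hz)).div_const _

@[fun_prop]
theorem measurable_poissonK : Measurable fun q : ℂ × UnitAddCircle => poissonK q.1 q.2 := by
  unfold poissonK
  fun_prop

theorem poissonK_lower {z : ℂ} (hz : ‖z‖ < 1) (s : UnitAddCircle) :
    (1 - ‖z‖) / 4 ≤ poissonK z s := by
  have h1 := one_sub_norm_le z s
  have h2 : ‖circlePt s - z‖ ≤ 2 := (norm_sub_le _ _).trans (by simp; linarith)
  have h3 : 0 < 1 - ‖z‖ := by linarith
  have h4 : ‖circlePt s - z‖ ^ 2 ≤ 4 := by nlinarith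
  rw [poissonK, div_le_div_iff₀ (by norm_num) (pow_pos (h3.trans_le h1) 2)]
  nlinarith [norm_nonneg z, mul_nonneg h3.le (norm_nonneg z)]

theorem poissonK_pos {z : ℂ} (hz : ‖z‖ < 1) (s : UnitAddCircle) : 0 < poissonK z s :=
  lt_of_lt_of_le (by linarith) (poissonK_lower hz s)

theorem poissonK_comm {ρ : ℝ} (hρ : 0 ≤ ρ) (hρ1 : ρ < 1) (s t : UnitAddCircle) :
    poissonK (ρ * circlePt t) s = poissonK (ρ * circlePt s) t := by
  rw [← two_mul_re_halfHerglotz, ← two_mul_re_halfHerglotz,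
    ← conj_halfHerglotz_ofReal_mul hρ hρ1 s t, conj_re]

/-! ### Integral formulas in one variable -/

theorem integrable_halfHerglotz_mul {z : ℂ} (hz : ‖z‖ < 1) {φ : UnitAddCircle → ℂ}
    (hφ : Integrable φ) : Integrable fun s => halfHerglotz z s * φ s :=
  hφ.bdd_mul (c := 1 / (1 - ‖z‖)) (continuous_halfHerglotz hz).aestronglyMeasurable
    (ae_of_all _ fun s => norm_halfHerglotz_le hz s)

theorem continuous_comp_circlePt {E : Type*} [TopologicalSpace E] {F : ℂ → E}
    (hF : ContinuousOn F (ball 0 1)) {r : ℝ} (hr : 0 ≤ r) (hr1 : r < 1) :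
    Continuous fun t => F (r * circlePt t) :=
  hF.comp_continuous (continuous_const.mul continuous_circlePt) fun t => by
    rw [mem_ball_zero_iff, norm_ofReal_mul_circlePt hr]; exact hr1

theorem integrable_of_continuous {X E : Type*} [TopologicalSpace X] [CompactSpace X]
    [MeasurableSpace X] [OpensMeasurableSpace X] [NormedAddCommGroup E]
    [SecondCountableTopologyEither X E] {μ : Measure X} [IsFiniteMeasure μ] {f : X → E}
    (hf : Continuous f) : Integrable f μ := by
  obtain ⟨C, hC⟩ := isCompact_univ.exists_bound_of_continuousOn hf.continuousOn
  exact Integrable.of_bound hf.aestronglyMeasurable C (ae_of_all _ fun x => hC x (mem_univ x))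

theorem integral_holomorphic_circlePt {F : ℂ → ℂ} (hF : DifferentiableOn ℂ F (ball 0 1)) {r : ℝ}
    (hr : 0 ≤ r) (hr1 : r < 1) : ∫ s, F (r * circlePt s) = F 0 := by
  rw [integral_circlePt]
  refine DiffContOnCl.circleAverage (DifferentiableOn.diffContOnCl ?_)
  refine hF.mono (closure_ball_subset_closedBall.trans (closedBall_subset_ball ?_))
  rwa [abs_of_nonneg hr]

theorem integral_halfHerglotz_mul_holomorphic {F : ℂ → ℂ}
    (hF : DifferentiableOn ℂ F (ball 0 1)) {r : ℝ} (hr : 0 < r) (hr1 : r < 1) {z : ℂ}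
    (hz : ‖z‖ < 1) :
    ∫ s, halfHerglotz z s * F (r * circlePt s) = F (r * z) - F 0 / 2 := by
  have hd : DiffContOnCl ℂ F (ball 0 |r|) := by
    refine DifferentiableOn.diffContOnCl ?_
    refine hF.mono (closure_ball_subset_closedBall.trans (closedBall_subset_ball ?_))
    rwa [abs_of_pos hr]
  have hr0 : (r : ℂ) ≠ 0 := by exact_mod_cast hr.ne'
  have hw : (r * z : ℂ) ∈ ball (0 : ℂ) |r| := by
    rw [mem_ball_zero_iff, norm_mul, norm_real, Real.norm_eq_abs, abs_of_pos hr]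
    nlinarith
  have h1 := hd.circleAverage_smul_div hw
  rw [← integral_circlePt (fun w => ((w - 0) / (w - r * z)) • F w)] at h1
  rw [← h1, ← integral_holomorphic_circlePt hF hr.le hr1, ← integral_div, ← integral_sub]
  · congr 1
    ext s
    have h2 := circlePt_sub_ne_zero hz s
    have h3 : (r * circlePt s - r * z : ℂ) ≠ 0 := by
      rw [← mul_sub]; exact mul_ne_zero hr0 h2
    simp only [halfHerglotz, sub_zero, smul_eq_mul]
    rw [show (r * circlePt s - r * z : ℂ) = r * (circlePt s - z) by ring]
    field_simp
    ring
  · refine integrable_of_continuous ?_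
    have hc := continuous_comp_circlePt hF.continuousOn hr.le hr1
    have hcirc : Continuous fun s => (r : ℂ) * circlePt s :=
      continuous_const.mul continuous_circlePt
    refine Continuous.mul (Continuous.div ?_ ?_ ?_) hc
    · exact (hcirc.sub continuous_const)
    · exact (hcirc.sub continuous_const)
    · intro s
      rw [← mul_sub]; exact mul_ne_zero hr0 (circlePt_sub_ne_zero hz s)
  · exact integrable_of_continuous
      ((continuous_comp_circlePt hF.continuousOn hr.le hr1).div_const _)

theorem integral_halfHerglotz_mul_conj {F : ℂ → ℂ}
    (hF : DifferentiableOn ℂ F (ball 0 1)) {r : ℝ} (hr : 0 < r) (hr1 : r < 1) {z : ℂ}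
    (hz : ‖z‖ < 1) :
    ∫ s, halfHerglotz z s * conj (F (r * circlePt s)) = conj (F 0) / 2 := by
  -- The conjugate of the integrand extends holomorphically to a neighbourhood of the closed disc.
  have hr0 : (r : ℂ) ≠ 0 := by exact_mod_cast hr.ne'
  have hcl : closure (ball (0 : ℂ) |r|) ⊆ closedBall 0 r := by
    rw [abs_of_pos hr]; exact closure_ball_subset_closedBall
  have hG : DiffContOnCl ℂ (fun w => (1 + conj z * (w / r)) / (1 - conj z * (w / r)) / 2 * F w)
      (ball 0 |r|) := by
    refine DifferentiableOn.diffContOnCl ?_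
    have hFd := hF.mono (hcl.trans (closedBall_subset_ball hr1))
    refine DifferentiableOn.mul (DifferentiableOn.div_const (DifferentiableOn.div ?_ ?_ ?_) _) hFd
    · fun_prop
    · fun_prop
    · intro w hw h
      have h1 : ‖conj z * (w / r)‖ = 1 := by rw [← sub_eq_zero.mp h]; simp
      have h2 : ‖w / r‖ ≤ 1 := by
        rw [norm_div, norm_real, Real.norm_eq_abs, abs_of_pos hr, div_le_one hr]
        simpa using hcl hw
      rw [norm_mul, RCLike.norm_conj] at h1
      nlinarith [norm_nonneg z, norm_nonneg (w / (r : ℂ))]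
  have h := hG.circleAverage
  rw [← integral_circlePt] at h
  simp only [zero_div, mul_zero, add_zero, sub_zero, div_one] at h
  have h2 : conj (F 0) / 2 = conj (1 / 2 * F 0) := by
    simp only [map_mul, map_div₀, map_one, map_ofNat]; ring
  rw [h2, ← h, ← integral_conj]
  congr 1
  ext s
  have hs := circlePt_mul_conj s
  have hne := circlePt_sub_ne_zero hz s
  have hne' : (1 - z * conj (circlePt s) : ℂ) ≠ 0 := by
    intro h0
    apply hne
    linear_combination circlePt s * h0 + (z : ℂ) * hs
  simp only [halfHerglotz, map_mul, map_div₀, map_add, map_sub, map_one, conj_conj, map_ofNat,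
    mul_div_cancel_left₀ _ hr0]
  congr 2
  rw [div_eq_div_iff hne hne']
  linear_combination (-2 : ℂ) * z * hs

/-- A complex-valued harmonic function on the disc is half the sum of a holomorphic function and
the conjugate of one. -/
theorem exists_eq_holomorphic_add_conj {w : ℂ → ℂ} (hw : HarmonicOnNhd w (ball 0 1)) :
    ∃ F G : ℂ → ℂ, DifferentiableOn ℂ F (ball 0 1) ∧ DifferentiableOn ℂ G (ball 0 1) ∧
      ∀ z ∈ ball (0 : ℂ) 1, w z = (F z + conj (G z)) / 2 := by
  obtain ⟨A, hA, hA'⟩ := (hw.comp_CLM reCLM).exists_analyticOnNhd_ball_re_eq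
  obtain ⟨B, hB, hB'⟩ := (hw.comp_CLM imCLM).exists_analyticOnNhd_ball_re_eq
  refine ⟨fun z => A z + I * B z, fun z => A z - I * B z, ?_, ?_, fun z hz => ?_⟩
  · exact hA.differentiableOn.add (hB.differentiableOn.const_mul _)
  · exact hA.differentiableOn.sub (hB.differentiableOn.const_mul _)
  · have h1 : (A z).re = (w z).re := hA' hz
    have h2 : (B z).re = (w z).im := hB' hz
    apply Complex.ext <;> simp [h1, h2] <;> ring

/-- For a harmonic `w`, the half Herglotz transform of the dilate `w (r ·)` is the dilate of a
function that does not depend on `r`. -/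
theorem exists_integral_halfHerglotz_mul_harmonic {w : ℂ → ℂ}
    (hw : HarmonicOnNhd w (ball 0 1)) :
    ∃ Q : ℂ → ℂ, ∀ r : ℝ, 0 < r → r < 1 → ∀ z : ℂ, ‖z‖ < 1 →
      ∫ s, halfHerglotz z s * w (r * circlePt s) = Q (r * z) := by
  obtain ⟨F, G, hF, hG, h⟩ := exists_eq_holomorphic_add_conj hw
  refine ⟨fun z => (F z - F 0 / 2 + conj (G 0) / 2) / 2, fun r hr hr1 z hz => ?_⟩
  have hcF := continuous_comp_circlePt hF.continuousOn hr.le hr1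
  have hcG := continuous_comp_circlePt hG.continuousOn hr.le hr1
  have hiG : Integrable fun s => conj (G (r * circlePt s)) :=
    integrable_of_continuous (continuous_conj.comp hcG)
  change _ = (F (r * z) - F 0 / 2 + conj (G 0) / 2) / 2
  rw [← integral_halfHerglotz_mul_holomorphic hF hr hr1 hz,
    ← integral_halfHerglotz_mul_conj hG hr hr1 hz, ← integral_add, ← integral_div]
  · congr 1
    ext s
    rw [h _ (by rw [mem_ball_zero_iff, norm_ofReal_mul_circlePt hr.le]; exact hr1)]
    ring
  · exact integrable_halfHerglotz_mul hz (integrable_of_continuous hcF)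
  · exact integrable_halfHerglotz_mul hz hiG

/-- The Poisson integral formula for complex-valued harmonic functions. -/
theorem integral_poissonK_mul_harmonic {w : ℂ → ℂ}
    (hw : HarmonicOnNhd w (ball 0 1)) {r : ℝ} (hr : 0 < r) (hr1 : r < 1) {z : ℂ}
    (hz : ‖z‖ < 1) :
    ∫ s, (poissonK z s : ℂ) * w (r * circlePt s) = w (r * z) := by
  have key : ∀ v : ℂ → ℝ, HarmonicOnNhd v (ball 0 1) →
      ∫ s, (poissonK z s : ℂ) * (v (r * circlePt s) : ℂ) = v (r * z) := by
    intro v hv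
    have hw' : (r * z : ℂ) ∈ ball (0 : ℂ) r := by
      rw [mem_ball_zero_iff, norm_mul, norm_real, Real.norm_eq_abs, abs_of_pos hr]
      nlinarith
    have h := (hv.mono (closedBall_subset_ball hr1)).circleAverage_poissonKernel_smul hw'
    have h2 := integral_circlePt (fun ζ => ((poissonKernel 0 (r * z) ζ * v ζ : ℝ) : ℂ)) r
    have h3 : Real.circleAverage (fun ζ => ((poissonKernel 0 (r * z) ζ * v ζ : ℝ) : ℂ)) 0 r =
        ((Real.circleAverage (poissonKernel 0 (r * z) • v) 0 r : ℝ) : ℂ) := by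
      rw [Real.circleAverage_def, Real.circleAverage_def, intervalIntegral.integral_ofReal,
        real_smul, smul_eq_mul, ofReal_mul]
      rfl
    rw [← h, ← h3, ← h2]
    congr 1
    ext s
    have : poissonKernel 0 (r * z) (r * circlePt s) = poissonK z s := by
      have hne := circlePt_sub_ne_zero hz s
      have hr0 := hr.ne'
      simp only [poissonKernel_def, sub_zero, ← mul_sub, norm_mul, norm_circlePt, poissonK,
        norm_real, Real.norm_eq_abs, abs_of_pos hr]
      have : ‖circlePt s - z‖ ≠ 0 := norm_ne_zero_iff.2 hne
      field_simp
    rw [this]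
    push_cast
    rfl
  have h1 := key _ (hw.comp_CLM reCLM)
  have h2 := key _ (hw.comp_CLM imCLM)
  simp only [Function.comp_apply, reCLM_apply, imCLM_apply] at h1 h2
  have hc := continuous_comp_circlePt hw.continuousOn hr.le hr1
  have hP : Continuous fun s => (poissonK z s : ℂ) := by
    simp only [← halfHerglotz_add_conj]
    exact (continuous_halfHerglotz hz).add (continuous_conj.comp (continuous_halfHerglotz hz))
  rw [← re_add_im (w (r * z)), ← h1, ← h2, ← integral_mul_const, ← integral_add]
  · congr 1
    ext s
    rw [mul_assoc, ← mul_add, re_add_im]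
  · exact integrable_of_continuous (hP.mul (continuous_ofReal.comp (continuous_re.comp hc)))
  · exact integrable_of_continuous
      ((hP.mul (continuous_ofReal.comp (continuous_im.comp hc))).mul continuous_const)

theorem integral_poissonK {z : ℂ} (hz : ‖z‖ < 1) : ∫ s, poissonK z s = 1 := by
  have h := integral_poissonK_mul_harmonic (w := fun _ => 1)
    (fun _ _ => harmonicAt_const _) (r := 1 / 2) (by norm_num) (by norm_num) hz
  simp only [mul_one] at h
  rw [integral_complex_ofReal] at h
  exact_mod_cast h

theorem lintegral_poissonK {z : ℂ} (hz : ‖z‖ < 1) :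
    ∫⁻ s, ENNReal.ofReal (poissonK z s) = 1 := by
  have h : Integrable (poissonK z) := by
    by_contra hn
    have := integral_undef hn
    rw [integral_poissonK hz] at this
    norm_num at this
  rw [← ofReal_integral_eq_lintegral_ofReal h (ae_of_all _ fun s => (poissonK_pos hz s).le),
    integral_poissonK hz, ENNReal.ofReal_one]

/-! ### The M. Riesz inequality on the circle -/

/-- The half Herglotz transform of a function on the circle, a holomorphic function on the disc. -/
def herglotzTransform (φ : UnitAddCircle → ℂ) (z : ℂ) : ℂ :=
  ∫ s, halfHerglotz z s * φ s

theorem differentiableOn_herglotzTransform {φ : UnitAddCircle → ℂ} (hφ : Integrable φ) :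
    DifferentiableOn ℂ (herglotzTransform φ) (ball 0 1) := by
  intro z₀ hz₀
  rw [mem_ball_zero_iff] at hz₀
  obtain ⟨R, hR, hR1⟩ := exists_between hz₀
  have hU : ball (0 : ℂ) R ∈ 𝓝 z₀ := isOpen_ball.mem_nhds (by simpa using hR)
  have hlt : ∀ z ∈ ball (0 : ℂ) R, ‖z‖ < 1 := fun z hz =>
    (mem_ball_zero_iff.1 hz).trans hR1
  refine (hasDerivAt_integral_of_dominated_loc_of_deriv_le (μ := volume)
    (F := fun z s => halfHerglotz z s * φ s)
    (F' := fun z s => circlePt s / (circlePt s - z) ^ 2 * φ s)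
    (bound := fun s => 1 / (1 - R) ^ 2 * ‖φ s‖) hU ?_ ?_ ?_ ?_ ?_
    ?_).2.differentiableAt.differentiableWithinAt
  · filter_upwards [hU] with z hz
    exact (integrable_halfHerglotz_mul (hlt z hz) hφ).aestronglyMeasurable
  · exact integrable_halfHerglotz_mul hz₀ hφ
  · refine AEStronglyMeasurable.mul ?_ hφ.aestronglyMeasurable
    have : Measurable fun s => circlePt s / (circlePt s - z₀) ^ 2 := by fun_prop
    exact this.aestronglyMeasurable
  · refine ae_of_all _ fun s z hz => ?_
    rw [norm_mul]
    gcongr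
    refine (norm_deriv_halfHerglotz_le (hlt z hz) s).trans ?_
    have := mem_ball_zero_iff.1 hz
    have h1 : 0 < 1 - R := by linarith
    gcongr
  · exact hφ.norm.const_mul _
  · exact ae_of_all _ fun s z hz => (hasDerivAt_halfHerglotz (hlt z hz) s).mul_const (φ s)

theorem continuous_herglotzTransform {φ : UnitAddCircle → ℂ} (hφ : Integrable φ) {ρ : ℝ}
    (hρ : 0 ≤ ρ) (hρ1 : ρ < 1) : Continuous fun t => herglotzTransform φ (ρ * circlePt t) :=
  continuous_comp_circlePt (differentiableOn_herglotzTransform hφ).continuousOn hρ hρ1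

/-- The elementary inequality behind the M. Riesz theorem: in the right half plane `|w| ^ p` is
dominated by `(Re w) ^ p` up to a harmonic function, because `cos (p θ) < 0` for `θ` near
`π / 2`. -/
theorem exists_norm_rpow_le {p : ℝ} (hp : 1 < p) (hp2 : p ≤ 2) :
    ∃ A B : ℝ, 0 ≤ A ∧ 0 ≤ B ∧ ∀ w : ℂ, 0 < w.re →
      ‖w‖ ^ p ≤ A * w.re ^ p - B * (w ^ (p : ℂ)).re := by
  have hpi := Real.pi_pos
  obtain ⟨θ₀, h1, h2⟩ : ∃ θ₀, Real.pi / (2 * p) < θ₀ ∧ θ₀ < Real.pi / 2 :=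
    exists_between (by gcongr; linarith)
  have hp0 : 0 < p := by linarith
  have h0 : 0 < θ₀ := lt_trans (by positivity) h1
  have hpθ : Real.pi / 2 < p * θ₀ := by
    rw [div_lt_iff₀ (by positivity)] at h1
    linarith
  have hc : Real.cos (p * θ₀) < 0 := by
    refine Real.cos_neg_of_pi_div_two_lt_of_lt hpθ ?_
    nlinarith
  have hc0 : 0 < Real.cos θ₀ := Real.cos_pos_of_mem_Ioo ⟨by linarith, h2⟩
  -- `B` makes the harmonic term sufficient for `|arg w| ≥ θ₀`, and `A` takes care of the rest.
  set B := 1 / (-Real.cos (p * θ₀)) with hB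
  have hBpos : 0 < B := by rw [hB]; exact one_div_pos.2 (by linarith)
  have hcp : 0 < Real.cos θ₀ ^ p := Real.rpow_pos_of_pos hc0 p
  refine ⟨(1 + B) / Real.cos θ₀ ^ p, B, by positivity, hBpos.le, fun w hw => ?_⟩
  have hw0 : w ≠ 0 := by rintro rfl; simp at hw
  have hn : 0 < ‖w‖ := norm_pos_iff.2 hw0
  have hre : w.re = ‖w‖ * Real.cos |w.arg| := by
    rw [Real.cos_abs, Complex.norm_mul_cos_arg]
  have harg : |w.arg| < Real.pi / 2 := abs_arg_lt_pi_div_two_iff.2 (Or.inl hw)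
  have hcos : 0 < Real.cos |w.arg| :=
    Real.cos_pos_of_mem_Ioo ⟨by linarith [abs_nonneg w.arg], harg⟩
  have hpow : (w ^ (p : ℂ)).re = ‖w‖ ^ p * Real.cos (p * |w.arg|) := by
    rw [cpow_ofReal_re, ← Real.cos_abs (w.arg * p), abs_mul, abs_of_pos hp0, mul_comm p]
  rw [hpow, hre, Real.mul_rpow hn.le hcos.le]
  have hnp : 0 < ‖w‖ ^ p := Real.rpow_pos_of_pos hn p
  suffices h : 1 ≤ (1 + B) / Real.cos θ₀ ^ p * Real.cos |w.arg| ^ p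
      - B * Real.cos (p * |w.arg|) by
    nlinarith
  have hcosp : 0 < Real.cos |w.arg| ^ p := Real.rpow_pos_of_pos hcos p
  rcases le_or_gt θ₀ |w.arg| with hθ | hθ
  · have h3 : Real.cos (p * |w.arg|) ≤ Real.cos (p * θ₀) := by
      refine Real.cos_le_cos_of_nonneg_of_le_pi (by positivity) (by nlinarith) (by gcongr)
    have h4 : B * Real.cos (p * |w.arg|) ≤ B * Real.cos (p * θ₀) := by gcongr
    have h5 : B * Real.cos (p * θ₀) = -1 := by
      rw [hB]; field_simp [hc.ne]
    have h6 : 0 ≤ (1 + B) / Real.cos θ₀ ^ p * Real.cos |w.arg| ^ p := by positivity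
    linarith
  · have h3 : Real.cos θ₀ ≤ Real.cos |w.arg| :=
      Real.cos_le_cos_of_nonneg_of_le_pi (abs_nonneg _) (by linarith) hθ.le
    have h4 : Real.cos θ₀ ^ p ≤ Real.cos |w.arg| ^ p := by gcongr
    have h5 : 1 + B ≤ (1 + B) / Real.cos θ₀ ^ p * Real.cos |w.arg| ^ p := by
      rw [div_mul_eq_mul_div, le_div_iff₀ hcp]
      gcongr
    have h6 := mul_le_mul_of_nonneg_left (Real.cos_le_one (p * |w.arg|)) hBpos.le
    linarith

/-- The Poisson integral is a contraction of `L ^ p`. -/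
theorem lintegral_poissonK_rpow_le {p : ℝ} (hp : 1 < p) {ρ : ℝ} (hρ : 0 ≤ ρ) (hρ1 : ρ < 1)
    {f : UnitAddCircle → ℝ≥0∞} (hf : Measurable f) :
    ∫⁻ t, (∫⁻ s, ENNReal.ofReal (poissonK (ρ * circlePt t) s) * f s) ^ p ≤ ∫⁻ s, f s ^ p := by
  have hlt : ∀ t, ‖(ρ * circlePt t : ℂ)‖ < 1 := fun t => by
    rwa [norm_ofReal_mul_circlePt hρ]
  have hmP : ∀ z, Measurable fun s => ENNReal.ofReal (poissonK z s) := fun z =>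
    (measurable_poissonK.comp (measurable_const.prodMk measurable_id)).ennreal_ofReal
  have jensen : ∀ t, (∫⁻ s, ENNReal.ofReal (poissonK (ρ * circlePt t) s) * f s) ^ p ≤
      ∫⁻ s, ENNReal.ofReal (poissonK (ρ * circlePt t) s) * f s ^ p := by
    intro t
    set ν := (volume : Measure UnitAddCircle).withDensity
      fun s => ENNReal.ofReal (poissonK (ρ * circlePt t) s) with hν
    have h1 : ν univ = 1 := by
      rw [hν, withDensity_apply _ MeasurableSet.univ, Measure.restrict_univ,
        lintegral_poissonK (hlt t)]
    have h2 := ENNReal.lintegral_mul_le_Lp_mul_Lq ν (Real.HolderConjugate.conjExponent hp)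
      hf.aemeasurable (g := fun _ => 1) aemeasurable_const
    simp only [Pi.mul_apply, mul_one, ENNReal.one_rpow, lintegral_one, h1] at h2
    have h3 := lintegral_withDensity_eq_lintegral_mul volume (hmP (ρ * circlePt t)) hf
    have h4 := lintegral_withDensity_eq_lintegral_mul volume (hmP (ρ * circlePt t))
      (hf.pow_const p)
    simp only [Pi.mul_apply] at h3 h4
    rw [← h3, ← h4]
    calc _ ≤ ((∫⁻ s, f s ^ p ∂ν) ^ (1 / p)) ^ p := by gcongr
      _ = _ := by rw [← ENNReal.rpow_mul, one_div_mul_cancel (by linarith), ENNReal.rpow_one]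
  calc _ ≤ ∫⁻ t, ∫⁻ s, ENNReal.ofReal (poissonK (ρ * circlePt t) s) * f s ^ p :=
        lintegral_mono jensen
    _ = ∫⁻ s, ∫⁻ t, ENNReal.ofReal (poissonK (ρ * circlePt t) s) * f s ^ p := by
        refine lintegral_lintegral_swap (Measurable.aemeasurable ?_)
        refine Measurable.mul (Measurable.ennreal_ofReal ?_) ((hf.comp measurable_snd).pow_const p)
        exact measurable_poissonK.comp (f := fun q : UnitAddCircle × UnitAddCircle =>
          ((ρ * circlePt q.1 : ℂ), q.2)) (by fun_prop)
    _ = ∫⁻ s, f s ^ p := by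
        congr 1
        ext s
        simp_rw [poissonK_comm hρ hρ1 s]
        rw [lintegral_mul_const _ (hmP _), lintegral_poissonK (hlt s), one_mul]

theorem integrable_halfHerglotz_mul_ofReal {φ : UnitAddCircle → ℝ} (hφ : Integrable φ) {z : ℂ}
    (hz : ‖z‖ < 1) : Integrable fun s => halfHerglotz z s * (φ s : ℂ) :=
  integrable_halfHerglotz_mul hz hφ.ofReal

theorem re_herglotzTransform {φ : UnitAddCircle → ℝ} (hφ : Integrable φ) {z : ℂ} (hz : ‖z‖ < 1) :
    (herglotzTransform (fun s => (φ s : ℂ)) z).re = (∫ s, poissonK z s * φ s) / 2 := by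
  have h := integral_re (𝕜 := ℂ) (integrable_halfHerglotz_mul hz hφ.ofReal)
  simp only [RCLike.re_to_complex, RCLike.ofReal_eq_complex_ofReal] at h
  rw [herglotzTransform, ← h, ← integral_div]
  congr 1
  ext s
  rw [← two_mul_re_halfHerglotz]
  simp
  ring

theorem integrable_poissonK_mul {φ : UnitAddCircle → ℝ} (hφ : Integrable φ) {z : ℂ}
    (hz : ‖z‖ < 1) : Integrable fun s => poissonK z s * φ s := by
  have h := (integrable_halfHerglotz_mul hz hφ.ofReal).re.const_mul 2
  refine h.congr (ae_of_all _ fun s => ?_)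
  dsimp only
  rw [← two_mul_re_halfHerglotz]
  simp
  ring

theorem memLp_of_lintegral_rpow_lt_top {X E : Type*} [MeasurableSpace X] {μ : Measure X}
    [NormedAddCommGroup E] {p : ℝ} (hp : 0 < p) {f : X → E} (hf : AEStronglyMeasurable f μ)
    (h : ∫⁻ x, ‖f x‖ₑ ^ p ∂μ < ∞) : MemLp f (ENNReal.ofReal p) μ := by
  refine ⟨hf, ?_⟩
  rw [eLpNorm_lt_top_iff_lintegral_rpow_enorm_lt_top (by simpa using hp) ENNReal.ofReal_ne_top,
    ENNReal.toReal_ofReal hp.le]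
  exact h

theorem integrable_of_lintegral_rpow_lt_top {X E : Type*} [MeasurableSpace X] {μ : Measure X}
    [IsFiniteMeasure μ] [NormedAddCommGroup E] {p : ℝ} (hp : 1 < p) {f : X → E}
    (hf : AEStronglyMeasurable f μ) (h : ∫⁻ x, ‖f x‖ₑ ^ p ∂μ < ∞) : Integrable f μ :=
  (memLp_of_lintegral_rpow_lt_top (by linarith) hf h).integrable
    (by simpa using hp.le)

/-- The M. Riesz inequality for nonnegative functions and `1 < p ≤ 2`: integrate the inequality
`exists_norm_rpow_le` over a circle, where the harmonic term has nonnegative mean. -/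
theorem riesz_nonneg {p : ℝ} (hp : 1 < p) (hp2 : p ≤ 2) :
    ∃ K : ℝ≥0∞, K ≠ ∞ ∧ ∀ ρ : ℝ, 0 ≤ ρ → ρ < 1 → ∀ φ : UnitAddCircle → ℝ, Measurable φ →
      (∀ s, 0 ≤ φ s) → Integrable φ →
      ∫⁻ t, ‖herglotzTransform (fun s => (φ s : ℂ)) (ρ * circlePt t)‖ₑ ^ p ≤
        K * ∫⁻ s, ‖φ s‖ₑ ^ p := by
  obtain ⟨A, B, hA, hB, hAB⟩ := exists_norm_rpow_le hp hp2
  have hp0 : 0 < p := by linarith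
  refine ⟨ENNReal.ofReal A, ENNReal.ofReal_ne_top, fun ρ hρ hρ1 φ hm h0 hi => ?_⟩
  set F := herglotzTransform (fun s => (φ s : ℂ)) with hF
  have hlt : ∀ t, ‖(ρ * circlePt t : ℂ)‖ < 1 := fun t => by
    rwa [norm_ofReal_mul_circlePt hρ]
  -- Unless `φ` vanishes, `Re F > 0`, so that `F ^ p` is holomorphic.
  rcases (integral_nonneg (μ := volume) (show 0 ≤ φ from h0)).eq_or_lt with hz | hpos
  · have hφ0 : φ =ᵐ[volume] 0 := (integral_eq_zero_iff_of_nonneg h0 hi).1 hz.symm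
    have hF0 : ∀ z, F z = 0 := fun z => by
      rw [hF, herglotzTransform]
      refine integral_eq_zero_of_ae ?_
      filter_upwards [hφ0] with s hs
      simp [hs]
    simp [hF0, hp0]
  have hre : ∀ z ∈ ball (0 : ℂ) 1, 0 < (F z).re := by
    intro z hz
    rw [mem_ball_zero_iff] at hz
    rw [hF, re_herglotzTransform hi hz]
    have h1 : ∫ s, (1 - ‖z‖) / 4 * φ s ≤ ∫ s, poissonK z s * φ s :=
      integral_mono (hi.const_mul _) (integrable_poissonK_mul hi hz) fun s => by
        have := h0 s
        have := poissonK_lower hz s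
        dsimp only
        gcongr
    rw [integral_const_mul] at h1
    have h2 : 0 < (1 - ‖z‖) / 4 * ∫ s, φ s := mul_pos (by linarith) hpos
    linarith
  have hFd : DifferentiableOn ℂ F (ball 0 1) := differentiableOn_herglotzTransform hi.ofReal
  have hGd : DifferentiableOn ℂ (fun z => F z ^ (p : ℂ)) (ball 0 1) :=
    hFd.cpow (differentiableOn_const _) fun z hz => Or.inl (hre z hz)
  have hmean := integral_holomorphic_circlePt hGd hρ hρ1
  have hFc := continuous_comp_circlePt hFd.continuousOn hρ hρ1
  have hGc := continuous_comp_circlePt hGd.continuousOn hρ hρ1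
  have hF0 : 0 ≤ (F 0 ^ (p : ℂ)).re := by
    have : F 0 = (((∫ s, φ s) / 2 : ℝ) : ℂ) := by
      rw [hF, herglotzTransform, ofReal_div, ← integral_complex_ofReal, ofReal_ofNat,
        ← integral_div]
      congr 1
      ext s
      simp only [halfHerglotz, add_zero, sub_zero, div_self (circlePt_ne_zero s)]
      ring
    rw [this, ← ofReal_cpow (by positivity), ofReal_re]
    positivity
  have hreint : 0 ≤ ∫ t, (F (ρ * circlePt t) ^ (p : ℂ)).re := by
    have := integral_re (𝕜 := ℂ) (integrable_of_continuous (μ := volume) hGc)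
    simp only [RCLike.re_to_complex] at this
    rw [this, hmean]
    exact hF0
  have hb : ∀ t, (ρ * circlePt t : ℂ) ∈ ball (0 : ℂ) 1 := fun t => by
    rw [mem_ball_zero_iff]; exact hlt t
  have hcn : Continuous fun t => ‖F (ρ * circlePt t)‖ ^ p :=
    hFc.norm.rpow_const fun _ => Or.inr hp0.le
  have hcr : Continuous fun t => (F (ρ * circlePt t)).re ^ p :=
    (continuous_re.comp hFc).rpow_const fun _ => Or.inr hp0.le
  have hreal : ∫ t, ‖F (ρ * circlePt t)‖ ^ p ≤ A * ∫ t, (F (ρ * circlePt t)).re ^ p := by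
    have hci : Integrable (fun t => (F (ρ * circlePt t) ^ (p : ℂ)).re) :=
      integrable_of_continuous (continuous_re.comp hGc)
    have h1 : ∫ t, ‖F (ρ * circlePt t)‖ ^ p ≤
        ∫ t, (A * (F (ρ * circlePt t)).re ^ p - B * (F (ρ * circlePt t) ^ (p : ℂ)).re) :=
      integral_mono (integrable_of_continuous hcn)
        (((integrable_of_continuous hcr).const_mul _).sub (hci.const_mul _))
        fun t => hAB _ (hre _ (hb t))
    rw [integral_sub ((integrable_of_continuous hcr).const_mul _) (hci.const_mul _),
      integral_const_mul, integral_const_mul] at h1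
    have := mul_nonneg hB hreint
    linarith
  have hL : ∫⁻ t, ‖F (ρ * circlePt t)‖ₑ ^ p = ENNReal.ofReal (∫ t, ‖F (ρ * circlePt t)‖ ^ p) := by
    rw [ofReal_integral_eq_lintegral_ofReal (integrable_of_continuous hcn)
      (ae_of_all _ fun t => by positivity)]
    congr 1
    ext t
    rw [← ENNReal.ofReal_rpow_of_nonneg (norm_nonneg _) hp0.le, ofReal_norm]
  have hR : ENNReal.ofReal (∫ t, (F (ρ * circlePt t)).re ^ p) ≤ ∫⁻ s, ‖φ s‖ₑ ^ p := by
    rw [ofReal_integral_eq_lintegral_ofReal (integrable_of_continuous hcr)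
      (ae_of_all _ fun t => Real.rpow_nonneg (hre _ (hb t)).le _)]
    refine le_trans (lintegral_mono fun t => ?_)
      (lintegral_poissonK_rpow_le hp hρ hρ1 hm.enorm)
    dsimp only
    rw [← ENNReal.ofReal_rpow_of_nonneg (hre _ (hb t)).le hp0.le]
    gcongr
    have h2 : ∀ s, 0 ≤ poissonK (ρ * circlePt t) s * φ s := fun s =>
      mul_nonneg (poissonK_pos (hlt t) s).le (h0 s)
    rw [hF, re_herglotzTransform hi (hlt t)]
    calc _ ≤ ENNReal.ofReal (∫ s, poissonK (ρ * circlePt t) s * φ s) :=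
          ENNReal.ofReal_le_ofReal (by
            linarith [integral_nonneg (μ := volume)
              (f := fun s => poissonK (ρ * circlePt t) s * φ s) h2])
      _ = _ := by
          rw [ofReal_integral_eq_lintegral_ofReal (integrable_poissonK_mul hi (hlt t))
            (ae_of_all _ h2)]
          congr 1
          ext s
          rw [ENNReal.ofReal_mul (poissonK_pos (hlt t) s).le, Real.enorm_eq_ofReal (h0 s)]
  rw [hL]
  calc _ ≤ ENNReal.ofReal (A * ∫ t, (F (ρ * circlePt t)).re ^ p) := ENNReal.ofReal_le_ofReal hreal
    _ = ENNReal.ofReal A * ENNReal.ofReal (∫ t, (F (ρ * circlePt t)).re ^ p) :=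
        ENNReal.ofReal_mul hA
    _ ≤ _ := by gcongr

theorem lintegral_enorm_add_rpow_le {X : Type*} [MeasurableSpace X] {μ : Measure X} {p : ℝ}
    (hp : 1 ≤ p) {f g h : X → ℂ} (hf : ∀ x, ‖f x‖ ≤ ‖g x‖ + ‖h x‖) (hg : Measurable g)
    {C : ℝ≥0∞} (hgC : ∫⁻ x, ‖g x‖ₑ ^ p ∂μ ≤ C) (hhC : ∫⁻ x, ‖h x‖ₑ ^ p ∂μ ≤ C) :
    ∫⁻ x, ‖f x‖ₑ ^ p ∂μ ≤ 2 ^ p * C := by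
  have hp0 : 0 ≤ p := by linarith
  calc ∫⁻ x, ‖f x‖ₑ ^ p ∂μ ≤ ∫⁻ x, 2 ^ (p - 1) * (‖g x‖ₑ ^ p + ‖h x‖ₑ ^ p) ∂μ := by
        refine lintegral_mono fun x => ?_
        refine le_trans ?_ (ENNReal.rpow_add_le_mul_rpow_add_rpow _ _ hp)
        gcongr
        rw [← ofReal_norm, ← ofReal_norm, ← ofReal_norm, ← ENNReal.ofReal_add (norm_nonneg _)
          (norm_nonneg _)]
        exact ENNReal.ofReal_le_ofReal (hf x)
    _ = 2 ^ (p - 1) * (∫⁻ x, ‖g x‖ₑ ^ p ∂μ + ∫⁻ x, ‖h x‖ₑ ^ p ∂μ) := by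
        rw [lintegral_const_mul' _ _ (ENNReal.rpow_ne_top_of_nonneg (by linarith) (by simp)),
          lintegral_add_left (hg.enorm.pow_const p)]
    _ ≤ 2 ^ (p - 1) * (C + C) := by gcongr
    _ = 2 ^ p * C := by
        rw [← two_mul, ← mul_assoc]
        congr 1
        nth_rewrite 2 [← ENNReal.rpow_one 2]
        rw [← ENNReal.rpow_add _ _ (by simp) (by simp)]
        simp

/-- The M. Riesz inequality with exponent `p`: the half Herglotz transform is bounded on
`L ^ p` of the circle, uniformly in the radius. Asking for `K ≠ 0` makes the right-hand side
infinite for `φ ∉ L ^ p`, where the transform may be a junk value. -/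
def RieszInequality (p : ℝ) : Prop :=
  ∃ K : ℝ≥0∞, K ≠ ∞ ∧ K ≠ 0 ∧ ∀ ρ : ℝ, 0 ≤ ρ → ρ < 1 → ∀ φ : UnitAddCircle → ℂ, Measurable φ →
    ∫⁻ t, ‖herglotzTransform φ (ρ * circlePt t)‖ₑ ^ p ≤ K * ∫⁻ s, ‖φ s‖ₑ ^ p

theorem measurable_herglotzTransform_circlePt {φ : UnitAddCircle → ℂ} (hφ : Integrable φ) {ρ : ℝ}
    (hρ : 0 ≤ ρ) (hρ1 : ρ < 1) : Measurable fun t => herglotzTransform φ (ρ * circlePt t) :=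
  (continuous_herglotzTransform hφ hρ hρ1).measurable

theorem rieszInequality_of_le_two {p : ℝ} (hp : 1 < p) (hp2 : p ≤ 2) : RieszInequality p := by
  obtain ⟨K, hK, h⟩ := riesz_nonneg hp hp2
  have hp0 : 0 ≤ p := by linarith
  -- From nonnegative to real functions, by the positive and the negative part.
  have hreal : ∀ ρ : ℝ, 0 ≤ ρ → ρ < 1 → ∀ φ : UnitAddCircle → ℝ, Measurable φ → Integrable φ →
      ∫⁻ t, ‖herglotzTransform (fun s => (φ s : ℂ)) (ρ * circlePt t)‖ₑ ^ p ≤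
        2 ^ p * (K * ∫⁻ s, ‖φ s‖ₑ ^ p) := by
    intro ρ hρ hρ1 φ hm hi
    have h1 := h ρ hρ hρ1 (fun s => max (φ s) 0) (hm.max measurable_const)
      (fun s => le_max_right _ _) hi.pos_part
    have h2 := h ρ hρ hρ1 (fun s => max (-φ s) 0) (hm.neg.max measurable_const)
      (fun s => le_max_right _ _) hi.neg_part
    refine lintegral_enorm_add_rpow_le hp.le (fun t => ?_)
      (measurable_herglotzTransform_circlePt hi.pos_part.ofReal hρ hρ1)
      (h1.trans ?_) (h2.trans ?_)
    · have hlt : ‖(ρ * circlePt t : ℂ)‖ < 1 := by rwa [norm_ofReal_mul_circlePt hρ]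
      refine le_trans (le_of_eq ?_) (norm_sub_le _ _)
      congr 1
      simp only [herglotzTransform]
      refine Eq.trans ?_ (integral_sub (integrable_halfHerglotz_mul_ofReal hi.pos_part hlt)
        (integrable_halfHerglotz_mul_ofReal hi.neg_part hlt))
      congr 1
      ext s
      have h3 : (φ s : ℂ) = ((max (φ s) 0 : ℝ) : ℂ) - ((max (-φ s) 0 : ℝ) : ℂ) := by
        rw [← ofReal_sub, max_zero_sub_max_neg_zero_eq_self]
      exact (congrArg _ h3).trans (mul_sub _ _ _)
    · gcongr with s
      rw [enorm_le_iff_norm_le, Real.norm_eq_abs, Real.norm_eq_abs,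
        abs_of_nonneg (le_max_right _ _)]
      exact max_le (le_abs_self _) (abs_nonneg _)
    · gcongr with s
      rw [enorm_le_iff_norm_le, Real.norm_eq_abs, Real.norm_eq_abs,
        abs_of_nonneg (le_max_right _ _)]
      exact max_le (neg_le_abs _) (abs_nonneg _)
  refine ⟨2 ^ p * (2 ^ p * K) + 1, by finiteness, by simp, fun ρ hρ hρ1 φ hm => ?_⟩
  by_cases hfin : ∫⁻ s, ‖φ s‖ₑ ^ p = ∞
  · rw [hfin, ENNReal.mul_top (by simp)]
    exact le_top
  have hi : Integrable φ := integrable_of_lintegral_rpow_lt_top hp hm.aestronglyMeasurable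
    (lt_top_iff_ne_top.2 hfin)
  have h1 := hreal ρ hρ hρ1 (fun s => (φ s).re) (measurable_re.comp hm) hi.re
  have h2 := hreal ρ hρ hρ1 (fun s => (φ s).im) (measurable_im.comp hm) hi.im
  have h3 : ∫⁻ t, ‖herglotzTransform φ (ρ * circlePt t)‖ₑ ^ p ≤
      2 ^ p * (2 ^ p * (K * ∫⁻ s, ‖φ s‖ₑ ^ p)) := by
    refine lintegral_enorm_add_rpow_le hp.le (fun t => ?_)
      (measurable_herglotzTransform_circlePt hi.re.ofReal hρ hρ1)
      (h1.trans ?_) (h2.trans ?_)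
    · have hlt : ‖(ρ * circlePt t : ℂ)‖ < 1 := by rwa [norm_ofReal_mul_circlePt hρ]
      have hI : ∀ z : ℂ, ‖z‖ = ‖I * z‖ := by simp
      rw [hI (herglotzTransform (fun s => ((φ s).im : ℂ)) (ρ * circlePt t))]
      refine le_trans (le_of_eq ?_) (norm_add_le _ _)
      congr 1
      simp only [herglotzTransform]
      rw [← integral_const_mul]
      refine Eq.trans ?_ (integral_add (integrable_halfHerglotz_mul_ofReal hi.re hlt)
        ((integrable_halfHerglotz_mul_ofReal hi.im hlt).const_mul I))
      congr 1
      ext s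
      have h3 := re_add_im (φ s)
      dsimp only [RCLike.re_to_complex, RCLike.im_to_complex]
      linear_combination -halfHerglotz (ρ * circlePt t) s * h3
    · gcongr with s
      exact enorm_le_iff_norm_le.2 (abs_re_le_norm _)
    · gcongr with s
      exact enorm_le_iff_norm_le.2 (abs_im_le_norm _)
  refine h3.trans ?_
  rw [← mul_assoc, ← mul_assoc]
  gcongr
  rw [mul_assoc]
  exact le_self_add

/-- Exponents above two, by duality: up to conjugation the transform on a circle is its own
transpose, and `|f| ^ (p - 2) * conj f` is the extremal test function for `f`. -/
theorem rieszInequality_of_two_lt {p : ℝ} (hp2 : 2 < p) : RieszInequality p := by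
  have hp : 1 < p := by linarith
  have hp0 : 0 < p := by linarith
  set q := p.conjExponent with hq
  have hpq : p.HolderConjugate q := Real.HolderConjugate.conjExponent hp
  have hq1 : 1 < q := hpq.symm.lt
  have hq0 : 0 < q := by linarith
  have hqp : q * (p - 1) = p := by rw [mul_comm]; exact hpq.sub_one_mul_conj
  have hq2 : q ≤ 2 := by nlinarith
  obtain ⟨K, hK, hK0, hR⟩ := rieszInequality_of_le_two hq1 hq2
  refine ⟨K ^ (p / q), ENNReal.rpow_ne_top_of_nonneg (by positivity) hK,
    (ENNReal.rpow_pos (pos_iff_ne_zero.2 hK0) hK).ne', fun ρ hρ hρ1 φ hm => ?_⟩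
  by_cases hfin : ∫⁻ s, ‖φ s‖ₑ ^ p = ∞
  · rw [hfin, ENNReal.mul_top (ENNReal.rpow_pos (pos_iff_ne_zero.2 hK0) hK).ne']
    exact le_top
  have hi : Integrable φ := integrable_of_lintegral_rpow_lt_top hp hm.aestronglyMeasurable
    (lt_top_iff_ne_top.2 hfin)
  have hlt : ∀ t, ‖(ρ * circlePt t : ℂ)‖ < 1 := fun t => by
    rwa [norm_ofReal_mul_circlePt hρ]
  set f : UnitAddCircle → ℂ := fun t => herglotzTransform φ (ρ * circlePt t) with hf
  have hfc : Continuous f := continuous_herglotzTransform hi hρ hρ1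
  set g : UnitAddCircle → ℂ := fun t => ((‖f t‖ ^ (p - 2) : ℝ) : ℂ) * conj (f t) with hg
  have hgc : Continuous g := by
    refine (continuous_ofReal.comp (hfc.norm.rpow_const fun _ => Or.inr (by linarith))).mul
      (continuous_conj.comp hfc)
  have hgn : ∀ t, ‖g t‖ = ‖f t‖ ^ (p - 1) := fun t => by
    rw [hg]
    dsimp only
    rw [norm_mul, norm_real, Real.norm_of_nonneg (by positivity), RCLike.norm_conj]
    nth_rewrite 2 [← Real.rpow_one ‖f t‖]
    rw [← Real.rpow_add_of_nonneg (norm_nonneg _) (by linarith) zero_le_one]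
    congr 1
    ring
  have hgf : ∀ t, f t * g t = ((‖f t‖ ^ p : ℝ) : ℂ) := fun t => by
    rw [hg]
    dsimp only
    rw [mul_left_comm, Complex.mul_conj, Complex.normSq_eq_norm_sq, ← ofReal_mul,
      ← Real.rpow_natCast, ← Real.rpow_add_of_nonneg (norm_nonneg _) (by linarith) (by simp)]
    congr 2
    push_cast
    ring
  have hcn : Continuous fun t => ‖f t‖ ^ p := hfc.norm.rpow_const fun _ => Or.inr hp0.le
  set X := ∫⁻ t, ‖f t‖ₑ ^ p with hX
  have hXreal : X = ENNReal.ofReal (∫ t, ‖f t‖ ^ p) := by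
    rw [ofReal_integral_eq_lintegral_ofReal (integrable_of_continuous hcn)
      (ae_of_all _ fun t => by positivity)]
    refine lintegral_congr fun t => ?_
    rw [← ENNReal.ofReal_rpow_of_nonneg (norm_nonneg _) hp0.le, ofReal_norm]
  have hkey : ((∫ t, ‖f t‖ ^ p : ℝ) : ℂ) =
      ∫ s, φ s * conj (herglotzTransform (fun t => conj (g t)) (ρ * circlePt s)) := by
    rw [← integral_complex_ofReal]
    have hgi : Integrable g := integrable_of_continuous hgc
    have hprod : Integrable (fun x : UnitAddCircle × UnitAddCircle =>
        halfHerglotz (ρ * circlePt x.1) x.2 * (g x.1 * φ x.2)) (volume.prod volume) := by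
      refine (hgi.mul_prod hi).bdd_mul (c := 1 / (1 - ρ))
        (Measurable.aestronglyMeasurable ?_) (ae_of_all _ fun x => ?_)
      · exact measurable_halfHerglotz.comp (f := fun q : UnitAddCircle × UnitAddCircle =>
          ((ρ * circlePt q.1 : ℂ), q.2)) (by fun_prop)
      · refine (norm_halfHerglotz_le (hlt _) _).trans_eq ?_
        rw [norm_ofReal_mul_circlePt hρ]
    calc ∫ t, ((‖f t‖ ^ p : ℝ) : ℂ)
        = ∫ t, ∫ s, halfHerglotz (ρ * circlePt t) s * (g t * φ s) := by
          congr 1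
          ext t
          rw [← hgf, hf]
          dsimp only
          rw [herglotzTransform, ← integral_mul_const]
          congr 1
          ext s
          ring
      _ = ∫ s, ∫ t, halfHerglotz (ρ * circlePt t) s * (g t * φ s) :=
          integral_integral_swap hprod
      _ = _ := by
          congr 1
          ext s
          rw [herglotzTransform, ← integral_conj, ← integral_const_mul]
          congr 1
          ext t
          rw [map_mul, conj_conj, conj_halfHerglotz_ofReal_mul hρ hρ1]
          ring
  have hgm : Measurable fun t => conj (g t) := (continuous_conj.comp hgc).measurable
  have hgi' : Integrable fun t => conj (g t) := integrable_of_continuous (continuous_conj.comp hgc)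
  have hgq : ∫⁻ t, ‖conj (g t)‖ₑ ^ q = X := by
    rw [hX]
    congr 1
    ext t
    rw [← ofReal_norm, RCLike.norm_conj, hgn, ← ENNReal.ofReal_rpow_of_nonneg (norm_nonneg _)
      (by linarith), ← ENNReal.rpow_mul, mul_comm (p - 1), hqp, ofReal_norm]
  have hle : X ≤ (∫⁻ s, ‖φ s‖ₑ ^ p) ^ (1 / p) * (K * X) ^ (1 / q) := by
    calc X = ‖((∫ t, ‖f t‖ ^ p : ℝ) : ℂ)‖ₑ := by
          rw [hXreal, ← ofReal_norm, norm_real, Real.norm_of_nonneg]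
          exact integral_nonneg fun t => by positivity
      _ ≤ ∫⁻ s, ‖φ s * conj (herglotzTransform (fun t => conj (g t)) (ρ * circlePt s))‖ₑ := by
          rw [hkey]
          exact enorm_integral_le_lintegral_enorm _
      _ = ∫⁻ s, ((fun s => ‖φ s‖ₑ) * fun s =>
            ‖herglotzTransform (fun t => conj (g t)) (ρ * circlePt s)‖ₑ) s := by
          congr 1
          ext s
          simp only [enorm_mul, Pi.mul_apply]
          rw [← ofReal_norm (conj _), RCLike.norm_conj, ofReal_norm]
      _ ≤ _ := by
          refine (ENNReal.lintegral_mul_le_Lp_mul_Lq volume hpq hm.enorm.aemeasurable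
            (measurable_herglotzTransform_circlePt hgi' hρ hρ1).enorm.aemeasurable).trans ?_
          gcongr
          rw [← hgq]
          exact hR ρ hρ hρ1 _ hgm
  have hXtop : X ≠ ∞ := by rw [hXreal]; exact ENNReal.ofReal_ne_top
  rcases eq_or_ne X 0 with h0 | h0
  · rw [h0]; exact zero_le
  -- Cancel `X ^ (1 / q)`, and take `p`-th powers.
  have hsum : 1 / p + 1 / q = 1 := by simpa using hpq.inv_add_inv_eq_one
  have hXq0 : X ^ (1 / q) ≠ 0 := (ENNReal.rpow_pos (pos_iff_ne_zero.2 h0) hXtop).ne'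
  have hXqt : X ^ (1 / q) ≠ ∞ := ENNReal.rpow_ne_top_of_nonneg (by positivity) hXtop
  have h1 : X ^ (1 / p) ≤ (∫⁻ s, ‖φ s‖ₑ ^ p) ^ (1 / p) * K ^ (1 / q) := by
    rw [← ENNReal.mul_le_mul_iff_left hXq0 hXqt, ← ENNReal.rpow_add _ _ h0 hXtop, hsum,
      ENNReal.rpow_one, mul_assoc, ← ENNReal.mul_rpow_of_nonneg _ _ (by positivity)]
    exact hle
  calc X = (X ^ (1 / p)) ^ p := by
        rw [← ENNReal.rpow_mul, one_div_mul_cancel hp0.ne', ENNReal.rpow_one]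
    _ ≤ ((∫⁻ s, ‖φ s‖ₑ ^ p) ^ (1 / p) * K ^ (1 / q)) ^ p := by gcongr
    _ = _ := by
        rw [ENNReal.mul_rpow_of_nonneg _ _ hp0.le, ← ENNReal.rpow_mul, ← ENNReal.rpow_mul,
          one_div_mul_cancel hp0.ne', ENNReal.rpow_one, mul_comm]
        congr 2
        ring

/-- **M. Riesz's theorem**. -/
theorem rieszInequality {p : ℝ} (hp : 1 < p) : RieszInequality p :=
  (le_or_gt p 2).elim (rieszInequality_of_le_two hp) rieszInequality_of_two_lt

/-! ### The product transform on the bidisc -/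

/-- The half Herglotz transform in both variables of a function on the torus. -/
def biHerglotz (g : Torus → ℂ) (z : ℂ × ℂ) : ℂ :=
  ∫ s : Torus, halfHerglotz z.1 s.1 * halfHerglotz z.2 s.2 * g s

theorem mem_bidisc {z : ℂ × ℂ} : z ∈ bidisc ↔ ‖z.1‖ < 1 ∧ ‖z.2‖ < 1 := by
  simp [bidisc, Set.mem_prod]

theorem isOpen_bidisc : IsOpen bidisc := isOpen_ball.prod isOpen_ball

theorem continuous_halfHerglotz_mul {z : ℂ × ℂ} (hz : z ∈ bidisc) :
    Continuous fun s : Torus => halfHerglotz z.1 s.1 * halfHerglotz z.2 s.2 := by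
  rw [mem_bidisc] at hz
  exact ((continuous_halfHerglotz hz.1).comp continuous_fst).mul
    ((continuous_halfHerglotz hz.2).comp continuous_snd)

theorem integrable_continuous_mul {X : Type*} [TopologicalSpace X] [CompactSpace X]
    [MeasurableSpace X] [OpensMeasurableSpace X] [SecondCountableTopology X] {μ : Measure X}
    {k g : X → ℂ} (hk : Continuous k) (hg : Integrable g μ) :
    Integrable (fun x => k x * g x) μ := by
  obtain ⟨C, hC⟩ := isCompact_univ.exists_bound_of_continuousOn hk.continuousOn
  exact hg.bdd_mul hk.aestronglyMeasurable (ae_of_all _ fun x => hC x (mem_univ x))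

/-- The derivative of `z ↦ halfHerglotz z.1 s.1 * halfHerglotz z.2 s.2`. -/
def fderivHalfHerglotzMul (z : ℂ × ℂ) (s : Torus) : ℂ × ℂ →L[ℂ] ℂ :=
  (halfHerglotz z.1 s.1 * (circlePt s.2 / (circlePt s.2 - z.2) ^ 2)) •
      ContinuousLinearMap.snd ℂ ℂ ℂ +
    (halfHerglotz z.2 s.2 * (circlePt s.1 / (circlePt s.1 - z.1) ^ 2)) •
      ContinuousLinearMap.fst ℂ ℂ ℂ

theorem hasFDerivAt_halfHerglotz_mul {z : ℂ × ℂ} (hz : z ∈ bidisc) (s : Torus) :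
    HasFDerivAt (fun z : ℂ × ℂ => halfHerglotz z.1 s.1 * halfHerglotz z.2 s.2)
      (fderivHalfHerglotzMul z s) z := by
  have hz' := mem_bidisc.1 hz
  have h1 := (hasDerivAt_halfHerglotz hz'.1 s.1).comp_hasFDerivAt z
    (hasFDerivAt_fst (𝕜 := ℂ) (p := z))
  have h2 := (hasDerivAt_halfHerglotz hz'.2 s.2).comp_hasFDerivAt z
    (hasFDerivAt_snd (𝕜 := ℂ) (p := z))
  have h := h1.mul h2
  rw [smul_smul, smul_smul] at h
  exact h

theorem norm_fderivHalfHerglotzMul_le {R : ℝ} (hR : R < 1) {z : ℂ × ℂ} (h₁ : ‖z.1‖ < R)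
    (h₂ : ‖z.2‖ < R) (s : Torus) :
    ‖fderivHalfHerglotzMul z s‖ ≤ 2 * (1 / (1 - R) * (1 / (1 - R) ^ 2)) := by
  have hR0 : 0 < 1 - R := by linarith
  have hk : ∀ w : ℂ, ‖w‖ < R → ∀ t, ‖halfHerglotz w t‖ ≤ 1 / (1 - R) := fun w hw t =>
    (norm_halfHerglotz_le (hw.trans hR) t).trans (by gcongr)
  have hd : ∀ w : ℂ, ‖w‖ < R → ∀ t, ‖circlePt t / (circlePt t - w) ^ 2‖ ≤ 1 / (1 - R) ^ 2 :=
    fun w hw t => (norm_deriv_halfHerglotz_le (hw.trans hR) t).trans (by gcongr)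
  have h0 : 0 ≤ 1 / (1 - R) := by positivity
  have hb : ∀ a b c : ℝ, 0 ≤ b → 0 ≤ c → a ≤ 1 / (1 - R) → b ≤ 1 / (1 - R) ^ 2 → c ≤ 1 →
      a * b * c ≤ 1 / (1 - R) * (1 / (1 - R) ^ 2) := fun a b c hb0 hc0 ha hb hc =>
    (mul_le_mul (mul_le_mul ha hb hb0 h0) hc hc0 (by positivity)).trans_eq (mul_one _)
  rw [fderivHalfHerglotzMul, two_mul]
  refine (norm_add_le _ _).trans (add_le_add ?_ ?_)
  · rw [norm_smul, norm_mul]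
    exact hb _ _ _ (norm_nonneg _) (norm_nonneg _) (hk _ h₁ _) (hd _ h₂ _)
      (ContinuousLinearMap.norm_snd_le ℂ ℂ ℂ)
  · rw [norm_smul, norm_mul]
    exact hb _ _ _ (norm_nonneg _) (norm_nonneg _) (hk _ h₂ _) (hd _ h₁ _)
      (ContinuousLinearMap.norm_fst_le ℂ ℂ ℂ)

theorem aestronglyMeasurable_fderivHalfHerglotzMul {z : ℂ × ℂ} (hz : z ∈ bidisc) :
    AEStronglyMeasurable (fderivHalfHerglotzMul z) volume := by
  have hz' := mem_bidisc.1 hz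
  have hk : ∀ w : ℂ, ‖w‖ < 1 → Continuous fun t => circlePt t / (circlePt t - w) ^ 2 :=
    fun w hw => continuous_circlePt.div ((continuous_circlePt.sub continuous_const).pow 2)
      fun t => pow_ne_zero 2 (circlePt_sub_ne_zero hw t)
  refine Continuous.aestronglyMeasurable (Continuous.add ?_ ?_)
  · exact (((continuous_halfHerglotz hz'.1).comp continuous_fst).mul
      ((hk _ hz'.2).comp continuous_snd)).smul continuous_const
  · exact (((continuous_halfHerglotz hz'.2).comp continuous_snd).mul
      ((hk _ hz'.1).comp continuous_fst)).smul continuous_const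

theorem differentiableOn_biHerglotz {g : Torus → ℂ} (hg : Integrable g) :
    DifferentiableOn ℂ (biHerglotz g) bidisc := by
  intro z₀ hz₀
  have hz₀' := mem_bidisc.1 hz₀
  obtain ⟨R, hR, hR1⟩ := exists_between (max_lt hz₀'.1 hz₀'.2)
  rw [max_lt_iff] at hR
  have hU : ball (0 : ℂ) R ×ˢ ball (0 : ℂ) R ∈ 𝓝 z₀ :=
    (isOpen_ball.prod isOpen_ball).mem_nhds (by simpa [Set.mem_prod] using hR)
  have hlt : ∀ z ∈ ball (0 : ℂ) R ×ˢ ball (0 : ℂ) R, ‖z.1‖ < R ∧ ‖z.2‖ < R := fun z hz => by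
    simpa [Set.mem_prod] using hz
  have hmem : ∀ z ∈ ball (0 : ℂ) R ×ˢ ball (0 : ℂ) R, z ∈ bidisc := fun z hz =>
    mem_bidisc.2 ⟨(hlt z hz).1.trans hR1, (hlt z hz).2.trans hR1⟩
  have h := hasFDerivAt_integral_of_dominated_of_fderiv_le (μ := volume) (𝕜 := ℂ)
    (F := fun z (s : Torus) => halfHerglotz z.1 s.1 * halfHerglotz z.2 s.2 * g s)
    (F' := fun z s => g s • fderivHalfHerglotzMul z s)
    (bound := fun s => ‖g s‖ * (2 * (1 / (1 - R) * (1 / (1 - R) ^ 2)))) hU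
    (by
      filter_upwards [hU] with z hz
      exact (integrable_continuous_mul (continuous_halfHerglotz_mul (hmem z hz))
        hg).aestronglyMeasurable)
    (integrable_continuous_mul (continuous_halfHerglotz_mul hz₀) hg)
    (hg.aestronglyMeasurable.smul (aestronglyMeasurable_fderivHalfHerglotzMul hz₀))
    (ae_of_all _ fun s z hz => by
      rw [norm_smul]
      exact mul_le_mul_of_nonneg_left
        (norm_fderivHalfHerglotzMul_le hR1 (hlt z hz).1 (hlt z hz).2 s) (norm_nonneg _))
    (hg.norm.mul_const _)
    (ae_of_all _ fun s z hz => (hasFDerivAt_halfHerglotz_mul (hmem z hz) s).mul_const (g s))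
  exact h.differentiableAt.differentiableWithinAt

theorem circle_mem_bidisc {r : ℝ} (hr : 0 ≤ r) (hr1 : r < 1) (t : Torus) :
    ((r * circlePt t.1, r * circlePt t.2) : ℂ × ℂ) ∈ bidisc := by
  rw [mem_bidisc, norm_ofReal_mul_circlePt hr, norm_ofReal_mul_circlePt hr]
  exact ⟨hr1, hr1⟩

theorem biHerglotz_eq_iterated {g : Torus → ℂ} (hg : Integrable g) {z : ℂ × ℂ}
    (hz : z ∈ bidisc) :
    biHerglotz g z = ∫ s₂, halfHerglotz z.2 s₂ * ∫ s₁, halfHerglotz z.1 s₁ * g (s₁, s₂) := by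
  rw [biHerglotz, Measure.volume_eq_prod, integral_prod_symm]
  · congr 1
    ext s₂
    rw [← integral_const_mul]
    congr 1
    ext s₁
    ring
  · exact integrable_continuous_mul (continuous_halfHerglotz_mul hz) hg

/-- The M. Riesz inequality on the torus, from the one on the circle in each variable. -/
theorem exists_lintegral_biHerglotz_le {p : ℝ} (hp : 1 < p) :
    ∃ K : ℝ≥0∞, K ≠ ∞ ∧ ∀ g : Torus → ℂ, Measurable g → ∫⁻ s, ‖g s‖ₑ ^ p < ∞ →
      ∀ r : ℝ, 0 ≤ r → r < 1 →
        ∫⁻ t : Torus, ‖biHerglotz g (r * circlePt t.1, r * circlePt t.2)‖ₑ ^ p ≤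
          K * ∫⁻ s, ‖g s‖ₑ ^ p := by
  obtain ⟨K, hK, -, h⟩ := rieszInequality hp
  refine ⟨K * K, ENNReal.mul_ne_top hK hK, fun g hm hfin r hr hr1 => ?_⟩
  have hi : Integrable g := integrable_of_lintegral_rpow_lt_top hp hm.aestronglyMeasurable hfin
  obtain ⟨k, hk⟩ : ∃ k : UnitAddCircle → UnitAddCircle → ℂ, ∀ t₁ s₂, k t₁ s₂ =
    herglotzTransform (fun s₁ => g (s₁, s₂)) (r * circlePt t₁) := ⟨_, fun _ _ => rfl⟩
  have hkm : Measurable fun q : UnitAddCircle × UnitAddCircle => k q.1 q.2 := by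
    have : StronglyMeasurable fun q : (UnitAddCircle × UnitAddCircle) × UnitAddCircle =>
        halfHerglotz (r * circlePt q.1.1) q.2 * g (q.2, q.1.2) := by
      refine (Measurable.mul ?_ (hm.comp (by fun_prop))).stronglyMeasurable
      exact measurable_halfHerglotz.comp
        (f := fun q : (UnitAddCircle × UnitAddCircle) × UnitAddCircle =>
          ((r * circlePt q.1.1 : ℂ), q.2)) (by fun_prop)
    simp only [hk]
    exact this.integral_prod_right'.measurable
  have heq : ∀ t : Torus, biHerglotz g (r * circlePt t.1, r * circlePt t.2) =
      herglotzTransform (k t.1) (r * circlePt t.2) := fun t => by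
    rw [biHerglotz_eq_iterated hi (circle_mem_bidisc hr hr1 t), herglotzTransform]
    simp only [hk, herglotzTransform]
  have hkp : Measurable fun q : UnitAddCircle × UnitAddCircle => ‖k q.1 q.2‖ₑ ^ p :=
    hkm.enorm.pow_const p
  have hswap : ∫⁻ t₁, ∫⁻ s₂, ‖k t₁ s₂‖ₑ ^ p = ∫⁻ s₂, ∫⁻ t₁, ‖k t₁ s₂‖ₑ ^ p :=
    lintegral_lintegral_swap hkp.aemeasurable
  calc ∫⁻ t : Torus, ‖biHerglotz g (r * circlePt t.1, r * circlePt t.2)‖ₑ ^ p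
      = ∫⁻ t : Torus, ‖herglotzTransform (k t.1) (r * circlePt t.2)‖ₑ ^ p := by simp_rw [heq]
    _ ≤ ∫⁻ t₁, ∫⁻ t₂, ‖herglotzTransform (k t₁) (r * circlePt t₂)‖ₑ ^ p := by
        rw [Measure.volume_eq_prod]
        exact lintegral_prod_le _
    _ ≤ ∫⁻ t₁, K * ∫⁻ s₂, ‖k t₁ s₂‖ₑ ^ p := by
        refine lintegral_mono fun t₁ => h r hr hr1 (k t₁) ?_
        exact hkm.comp measurable_prodMk_left
    _ = K * ∫⁻ s₂, ∫⁻ t₁, ‖k t₁ s₂‖ₑ ^ p := by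
        rw [lintegral_const_mul' _ _ hK, hswap]
    _ ≤ K * ∫⁻ s₂, K * ∫⁻ s₁, ‖g (s₁, s₂)‖ₑ ^ p := by
        simp only [hk]
        gcongr with s₂
        exact h r hr hr1 _ (hm.comp measurable_prodMk_right)
    _ = K * K * ∫⁻ s, ‖g s‖ₑ ^ p := by
        rw [lintegral_const_mul' _ _ hK, ← mul_assoc, Measure.volume_eq_prod,
          lintegral_prod_symm' _ (hm.enorm.pow_const p)]

theorem memHolHardy_biHerglotz {p : ℝ} (hp : 1 < p) {g : Torus → ℂ} (hm : Measurable g)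
    (hfin : ∫⁻ s, ‖g s‖ₑ ^ p < ∞) : MemHolHardy p (biHerglotz g) := by
  obtain ⟨K, hK, h⟩ := exists_lintegral_biHerglotz_le hp
  refine ⟨differentiableOn_biHerglotz
    (integrable_of_lintegral_rpow_lt_top hp hm.aestronglyMeasurable hfin), ?_⟩
  exact (iSup₂_le fun r hr => h g hm hfin r hr.1.le hr.2).trans_lt
    (ENNReal.mul_lt_top hK.lt_top hfin)

/-! ### Splitting Poisson integrals into holomorphic pieces -/

/-- Complex conjugation in the first variable. -/
def conjFst (z : ℂ × ℂ) : ℂ × ℂ := (conj z.1, z.2)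

/-- The boundary version of `conjFst`. -/
def negFst (s : Torus) : Torus := (-s.1, s.2)

theorem measurePreserving_negFst : MeasurePreserving negFst := by
  have h1 : MeasurePreserving (fun x : UnitAddCircle => -x) := Measure.measurePreserving_neg _
  exact h1.prod (MeasurePreserving.id _)

theorem integral_comp_negFst (f : Torus → ℂ) : ∫ s, f (negFst s) = ∫ s, f s :=
  measurePreserving_negFst.integral_comp
    ((MeasurableEquiv.neg UnitAddCircle).prodCongr
      (MeasurableEquiv.refl UnitAddCircle)).measurableEmbedding f

theorem lintegral_comp_negFst (f : Torus → ℝ≥0∞) : ∫⁻ s, f (negFst s) = ∫⁻ s, f s :=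
  measurePreserving_negFst.lintegral_comp_emb
    ((MeasurableEquiv.neg UnitAddCircle).prodCongr
      (MeasurableEquiv.refl UnitAddCircle)).measurableEmbedding f

theorem integrable_comp_negFst {g : Torus → ℂ} (hg : Integrable g) :
    Integrable fun s => g (negFst s) :=
  measurePreserving_negFst.integrable_comp_of_integrable hg

theorem conjFst_mem_bidisc {z : ℂ × ℂ} (hz : z ∈ bidisc) : conjFst z ∈ bidisc := by
  simpa [conjFst, mem_bidisc] using hz

/-- The Poisson integral on the bidisc of a function on the torus. -/
def biPoisson (g : Torus → ℂ) (z : ℂ × ℂ) : ℂ :=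
  ∫ s : Torus, (poissonK z.1 s.1 : ℂ) * (poissonK z.2 s.2 : ℂ) * g s

theorem integrable_conj {X : Type*} [MeasurableSpace X] {μ : Measure X} {g : X → ℂ}
    (hg : Integrable g μ) : Integrable (fun x => conj (g x)) μ :=
  (LinearIsometryEquiv.integrable_comp_iff conjLIE).2 hg

/-- Expanding `(h₁ + conj h₁) * (h₂ + conj h₂)`, where `hⱼ` is the half Herglotz kernel in the
`j`-th variable, splits a Poisson integral into functions that are holomorphic up to conjugation
of the first variable and of the value. -/
theorem biPoisson_eq {g : Torus → ℂ} (hg : Integrable g) {z : ℂ × ℂ} (hz : z ∈ bidisc) :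
    biPoisson g z = biHerglotz g z + biHerglotz (fun s => g (negFst s)) (conjFst z) +
      (conj (biHerglotz (fun s => conj (g (negFst s))) (conjFst z)) +
        conj (biHerglotz (fun s => conj (g s)) z)) := by
  have hneg : ∀ G : Torus → ℂ, biHerglotz (fun s => G (negFst s)) (conjFst z) =
      ∫ s : Torus, conj (halfHerglotz z.1 s.1) * halfHerglotz z.2 s.2 * G s := by
    intro G
    rw [← integral_comp_negFst]
    simp only [biHerglotz, conj_halfHerglotz, negFst, conjFst, neg_neg]
  have hc1 := continuous_halfHerglotz_mul hz
  have hc2 : Continuous fun s : Torus => conj (halfHerglotz z.1 s.1) * halfHerglotz z.2 s.2 := by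
    rw [mem_bidisc] at hz
    exact (continuous_conj.comp ((continuous_halfHerglotz hz.1).comp continuous_fst)).mul
      ((continuous_halfHerglotz hz.2).comp continuous_snd)
  rw [hneg g, hneg fun s => conj (g s)]
  simp only [biHerglotz, biPoisson, ← integral_conj]
  rw [← integral_add (integrable_continuous_mul hc1 hg) (integrable_continuous_mul hc2 hg),
    ← integral_add (integrable_conj (integrable_continuous_mul hc2 (integrable_conj hg)))
      (integrable_conj (integrable_continuous_mul hc1 (integrable_conj hg))),
    ← integral_add]
  · congr 1
    ext s
    simp only [← halfHerglotz_add_conj, map_mul, conj_conj]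
    ring
  · exact (integrable_continuous_mul hc1 hg).add (integrable_continuous_mul hc2 hg)
  · exact (integrable_conj (integrable_continuous_mul hc2 (integrable_conj hg))).add
      (integrable_conj (integrable_continuous_mul hc1 (integrable_conj hg)))

/-- The form in which the two Carleson conditions are used: that on `σ_* μ` says that `f ∘ σ` is in
`L ^ p (μ)` for `f ∈ H ^ p`. -/
theorem memLpBidisc_of_eq {p : ℝ} {μ : Measure (Disc × Disc)} (hμ : IsHolCarleson p μ)
    (hσμ : IsHolCarleson p (μ.map sigma)) {f₁ f₂ f₃ f₄ u : ℂ × ℂ → ℂ} (h₁ : MemHolHardy p f₁)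
    (h₂ : MemHolHardy p f₂) (h₃ : MemHolHardy p f₃) (h₄ : MemHolHardy p f₄)
    (hu : ∀ z ∈ bidisc, u z =
      f₁ z + f₂ (conjFst z) + (conj (f₃ (conjFst z)) + conj (f₄ z))) :
    MemLpBidisc p μ u := by
  have hs : ∀ f, MemHolHardy p f → MemLp (fun z : Disc × Disc => f (conjFst (z.1, z.2)))
      (ENNReal.ofReal p) μ := fun f hf =>
    (memLp_map_measure_iff (hσμ f hf).1 measurable_sigma.aemeasurable).1 (hσμ f hf)
  have hc : ∀ f : Disc × Disc → ℂ, MemLp f (ENNReal.ofReal p) μ →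
      MemLp (fun z => conj (f z)) (ENNReal.ofReal p) μ := fun f hf => hf.star
  have h := ((hμ f₁ h₁).add (hs f₂ h₂)).add ((hc _ (hs f₃ h₃)).add (hc _ (hμ f₄ h₄)))
  have heq : (fun z : Disc × Disc => u (z.1, z.2)) = fun z : Disc × Disc =>
      f₁ (z.1, z.2) + f₂ (conjFst (z.1, z.2)) +
        (conj (f₃ (conjFst (z.1, z.2))) + conj (f₄ (z.1, z.2))) :=
    funext fun z => hu _ ⟨z.1.2, z.2.2⟩
  rw [MemLpBidisc, heq]
  exact h

theorem memLpBidisc_biPoisson {p : ℝ} (hp : 1 < p) {μ : Measure (Disc × Disc)}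
    (hμ : IsHolCarleson p μ) (hσμ : IsHolCarleson p (μ.map sigma)) {g : Torus → ℂ}
    (hm : Measurable g) (hfin : ∫⁻ s, ‖g s‖ₑ ^ p < ∞) : MemLpBidisc p μ (biPoisson g) := by
  have hi : Integrable g := integrable_of_lintegral_rpow_lt_top hp hm.aestronglyMeasurable hfin
  have hconj : ∀ w : ℂ, ‖conj w‖ₑ = ‖w‖ₑ := fun w => by
    rw [← ofReal_norm, RCLike.norm_conj, ofReal_norm]
  have hm' := hm.comp measurePreserving_negFst.measurable
  have hfin' : ∫⁻ s, ‖g (negFst s)‖ₑ ^ p < ∞ := by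
    rwa [lintegral_comp_negFst fun s => ‖g s‖ₑ ^ p]
  refine memLpBidisc_of_eq hμ hσμ (memHolHardy_biHerglotz hp hm hfin)
    (memHolHardy_biHerglotz hp hm' hfin')
    (memHolHardy_biHerglotz hp (continuous_conj.measurable.comp hm') ?_)
    (memHolHardy_biHerglotz hp (continuous_conj.measurable.comp hm) ?_)
    fun z hz => biPoisson_eq hi hz
  · simpa only [Function.comp_apply, hconj] using hfin'
  · simpa only [Function.comp_apply, hconj] using hfin

/-! ### Separately harmonic functions -/

/-- Continuous functions on the bidisc that are harmonic in each variable. -/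
structure IsSepHarmonic (v : ℂ × ℂ → ℂ) : Prop where
  continuousOn : ContinuousOn v bidisc
  fst : ∀ w ∈ ball (0 : ℂ) 1, HarmonicOnNhd (fun z : ℂ => v (z, w)) (ball 0 1)
  snd : ∀ z ∈ ball (0 : ℂ) 1, HarmonicOnNhd (fun w : ℂ => v (z, w)) (ball 0 1)

theorem harmonicOnNhd_conj {w : ℂ → ℂ} (hw : HarmonicOnNhd w (ball 0 1)) :
    HarmonicOnNhd (fun z => conj (w z)) (ball 0 1) :=
  hw.comp_CLM (conjCLE : ℂ →L[ℝ] ℂ)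

theorem harmonicOnNhd_comp_conj {w : ℂ → ℂ} (hw : HarmonicOnNhd w (ball 0 1)) :
    HarmonicOnNhd (fun z => w (conj z)) (ball 0 1) := by
  obtain ⟨F, G, hF, hG, h⟩ := exists_eq_holomorphic_add_conj hw
  have hana : ∀ H : ℂ → ℂ, DifferentiableOn ℂ H (ball 0 1) → ∀ z ∈ ball (0 : ℂ) 1,
      AnalyticAt ℂ (conj ∘ H ∘ conj) z := by
    intro H hH z hz
    refine DifferentiableOn.analyticAt (s := ball 0 1) (fun y hy => ?_) (isOpen_ball.mem_nhds hz)
    have hy' : conj y ∈ ball (0 : ℂ) 1 := by simpa using hy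
    have h1 := (hH.differentiableAt (isOpen_ball.mem_nhds hy')).conj_conj
    rw [conj_conj] at h1
    exact h1.differentiableWithinAt
  intro z hz
  have h1 := ((hana G hG z hz).harmonicAt.add
    (((hana F hF z hz).harmonicAt).comp_CLM (conjCLE : ℂ →L[ℝ] ℂ))).const_smul (c := (1 / 2 : ℝ))
  refine (harmonicAt_congr_nhds ?_).1 h1
  filter_upwards [isOpen_ball.mem_nhds hz] with y hy
  have hy' : conj y ∈ ball (0 : ℂ) 1 := by simpa using hy
  rw [h _ hy']
  simp
  ring

theorem continuousOn_conjFst : ContinuousOn conjFst bidisc := by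
  unfold conjFst
  exact ((continuous_conj.comp continuous_fst).prodMk continuous_snd).continuousOn

theorem IsSepHarmonic.comp_conjFst {v : ℂ × ℂ → ℂ} (hv : IsSepHarmonic v) :
    IsSepHarmonic fun z => v (conjFst z) where
  continuousOn := hv.continuousOn.comp continuousOn_conjFst fun _ => conjFst_mem_bidisc
  fst w hw := harmonicOnNhd_comp_conj (hv.fst w hw)
  snd z hz := hv.snd (conj z) (by simpa using hz)

theorem IsSepHarmonic.conj {v : ℂ × ℂ → ℂ} (hv : IsSepHarmonic v) :
    IsSepHarmonic fun z => conj (v z) where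
  continuousOn := continuous_conj.comp_continuousOn hv.continuousOn
  fst w hw := harmonicOnNhd_conj (hv.fst w hw)
  snd z hz := harmonicOnNhd_conj (hv.snd z hz)

/-- The restriction of `v` to the torus with radii `r₁` and `r₂`. -/
def onTorus (v : ℂ × ℂ → ℂ) (r₁ r₂ : ℝ) (s : Torus) : ℂ :=
  v (r₁ * circlePt s.1, r₂ * circlePt s.2)

theorem IsSepHarmonic.continuous_onTorus {v : ℂ × ℂ → ℂ} (hv : IsSepHarmonic v) {r₁ r₂ : ℝ}
    (h₁ : r₁ ∈ Ioo (0 : ℝ) 1) (h₂ : r₂ ∈ Ioo (0 : ℝ) 1) : Continuous (onTorus v r₁ r₂) := by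
  refine hv.continuousOn.comp_continuous (Continuous.prodMk
    (continuous_const.mul (continuous_circlePt.comp continuous_fst))
    (continuous_const.mul (continuous_circlePt.comp continuous_snd))) fun s => ?_
  rw [mem_bidisc, norm_ofReal_mul_circlePt h₁.1.le, norm_ofReal_mul_circlePt h₂.1.le]
  exact ⟨h₁.2, h₂.2⟩

theorem circle_mem_ball {r : ℝ} (hr : r ∈ Ioo (0 : ℝ) 1) (t : UnitAddCircle) :
    (r * circlePt t : ℂ) ∈ ball (0 : ℂ) 1 := by
  rw [mem_ball_zero_iff, norm_ofReal_mul_circlePt hr.1.le]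
  exact hr.2

theorem halfHerglotz_harmonic_congr {w : ℂ → ℂ} (hw : HarmonicOnNhd w (ball 0 1)) {r r' : ℝ}
    (hr : r ∈ Ioo (0 : ℝ) 1) (hr' : r' ∈ Ioo (0 : ℝ) 1) {z z' : ℂ} (hz : ‖z‖ < 1) (hz' : ‖z'‖ < 1)
    (h : r * z = r' * z') :
    ∫ s, halfHerglotz z s * w (r * circlePt s) = ∫ s, halfHerglotz z' s * w (r' * circlePt s) := by
  obtain ⟨Q, hQ⟩ := exists_integral_halfHerglotz_mul_harmonic hw
  rw [hQ r hr.1 hr.2 z hz, hQ r' hr'.1 hr'.2 z' hz', h]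

theorem biHerglotz_eq_iterated' {g : Torus → ℂ} (hg : Integrable g) {z : ℂ × ℂ}
    (hz : z ∈ bidisc) :
    biHerglotz g z = ∫ s₁, halfHerglotz z.1 s₁ * ∫ s₂, halfHerglotz z.2 s₂ * g (s₁, s₂) := by
  rw [biHerglotz, Measure.volume_eq_prod, integral_prod]
  · congr 1
    ext s₁
    rw [← integral_const_mul]
    congr 1
    ext s₂
    ring
  · exact integrable_continuous_mul (continuous_halfHerglotz_mul hz) hg

/-- The transform of the restriction of a separately harmonic function to a torus does not depend
on the radii of the torus, up to scaling. -/
theorem IsSepHarmonic.biHerglotz_onTorus_congr {v : ℂ × ℂ → ℂ} (hv : IsSepHarmonic v) {r r' : ℝ}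
    (hr : r ∈ Ioo (0 : ℝ) 1) (hr' : r' ∈ Ioo (0 : ℝ) 1) {z z' : ℂ × ℂ} (hz : z ∈ bidisc)
    (hz' : z' ∈ bidisc) (h : (r : ℂ) • z = (r' : ℂ) • z') :
    biHerglotz (onTorus v r r) z = biHerglotz (onTorus v r' r') z' := by
  have hz1 := mem_bidisc.1 hz
  have hz1' := mem_bidisc.1 hz'
  have hm : (z'.1, z.2) ∈ bidisc := mem_bidisc.2 ⟨hz1'.1, hz1.2⟩
  have e1 : (r * z.1 : ℂ) = r' * z'.1 := congrArg Prod.fst h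
  have e2 : (r * z.2 : ℂ) = r' * z'.2 := congrArg Prod.snd h
  calc biHerglotz (onTorus v r r) z = biHerglotz (onTorus v r' r) (z'.1, z.2) := by
        rw [biHerglotz_eq_iterated (integrable_of_continuous (hv.continuous_onTorus hr hr)) hz,
          biHerglotz_eq_iterated (integrable_of_continuous (hv.continuous_onTorus hr' hr)) hm]
        congr 1
        ext s₂
        congr 1
        exact halfHerglotz_harmonic_congr (hv.fst _ (circle_mem_ball hr s₂)) hr hr' hz1.1 hz1'.1 e1
    _ = biHerglotz (onTorus v r' r') z' := by
        rw [biHerglotz_eq_iterated' (integrable_of_continuous (hv.continuous_onTorus hr' hr)) hm,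
          biHerglotz_eq_iterated' (integrable_of_continuous (hv.continuous_onTorus hr' hr')) hz']
        congr 1
        ext s₁
        congr 1
        exact halfHerglotz_harmonic_congr (hv.snd _ (circle_mem_ball hr' s₁)) hr hr' hz1.2 hz1'.2 e2

theorem inv_smul_mem_bidisc {r : ℝ} (hr : 0 < r) {z : ℂ × ℂ} (h₁ : ‖z.1‖ < r) (h₂ : ‖z.2‖ < r) :
    (r : ℂ)⁻¹ • z ∈ bidisc := by
  rw [mem_bidisc]
  simp only [Prod.smul_fst, Prod.smul_snd, smul_eq_mul, norm_mul, norm_inv, norm_real,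
    Real.norm_of_nonneg hr.le]
  rw [inv_mul_lt_one₀ hr, inv_mul_lt_one₀ hr]
  exact ⟨h₁, h₂⟩

/-- The four holomorphic constituents of `u ∈ h ^ p` arise from this lemma, applied to `u`, to its
conjugate, and to both composed with `conjFst`. -/
theorem IsSepHarmonic.exists_memHolHardy {p : ℝ} (hp : 1 < p) {v : ℂ × ℂ → ℂ}
    (hv : IsSepHarmonic v) (hfin : hardyNormPow p v < ∞) :
    ∃ f : ℂ × ℂ → ℂ, MemHolHardy p f ∧ ∀ r ∈ Ioo (0 : ℝ) 1, ∀ z ∈ bidisc,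
      biHerglotz (onTorus v r r) z = f ((r : ℂ) • z) := by
  -- Any radius between `max ‖z.1‖ ‖z.2‖` and `1` gives the same value at `z`.
  set R : ℂ × ℂ → ℝ := fun z => (1 + max ‖z.1‖ ‖z.2‖) / 2 with hR
  have hRmem : ∀ z ∈ bidisc, R z ∈ Ioo (0 : ℝ) 1 ∧ ‖z.1‖ < R z ∧ ‖z.2‖ < R z := by
    intro z hz
    rw [mem_bidisc] at hz
    have h1 := le_max_left ‖z.1‖ ‖z.2‖
    have h2 := le_max_right ‖z.1‖ ‖z.2‖
    have h3 := max_lt hz.1 hz.2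
    have h4 := norm_nonneg z.1
    simp only [hR, mem_Ioo]
    refine ⟨⟨?_, ?_⟩, ?_, ?_⟩ <;> linarith
  set f : ℂ × ℂ → ℂ := fun z => biHerglotz (onTorus v (R z) (R z)) ((R z : ℂ)⁻¹ • z) with hf
  have hne : ∀ r : ℝ, 0 < r → (r : ℂ) ≠ 0 := fun r hr => by exact_mod_cast hr.ne'
  have key : ∀ r ∈ Ioo (0 : ℝ) 1, ∀ z ∈ bidisc,
      biHerglotz (onTorus v r r) z = f ((r : ℂ) • z) := by
    intro r hr z hz
    have hz' := mem_bidisc.1 hz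
    have hrz : (r : ℂ) • z ∈ bidisc := by
      rw [mem_bidisc]
      simp only [Prod.smul_fst, Prod.smul_snd, smul_eq_mul, norm_mul, norm_real,
        Real.norm_of_nonneg hr.1.le]
      constructor
      · nlinarith [hr.1, hr.2, hz'.1, norm_nonneg z.1]
      · nlinarith [hr.1, hr.2, hz'.2, norm_nonneg z.2]
    obtain ⟨h1, h2, h3⟩ := hRmem _ hrz
    refine hv.biHerglotz_onTorus_congr hr h1 hz (inv_smul_mem_bidisc h1.1 h2 h3) ?_
    rw [smul_inv_smul₀ (hne _ h1.1)]
  have key' : ∀ r ∈ Ioo (0 : ℝ) 1, ∀ z : ℂ × ℂ, ‖z.1‖ < r → ‖z.2‖ < r →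
      f z = biHerglotz (onTorus v r r) ((r : ℂ)⁻¹ • z) := by
    intro r hr z h1 h2
    rw [key r hr _ (inv_smul_mem_bidisc hr.1 h1 h2), smul_inv_smul₀ (hne _ hr.1)]
  refine ⟨f, ⟨fun z₀ hz₀ => ?_, ?_⟩, key⟩
  · obtain ⟨h1, h2, h3⟩ := hRmem z₀ hz₀
    have hd : DifferentiableAt ℂ (fun z : ℂ × ℂ =>
        biHerglotz (onTorus v (R z₀) (R z₀)) ((R z₀ : ℂ)⁻¹ • z)) z₀ := by
      refine DifferentiableAt.fun_comp' (f := fun z : ℂ × ℂ => (R z₀ : ℂ)⁻¹ • z) z₀ ?_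
        (differentiableAt_fun_id.fun_const_smul _)
      exact (differentiableOn_biHerglotz (integrable_of_continuous
        (hv.continuous_onTorus h1 h1))).differentiableAt
          (isOpen_bidisc.mem_nhds (inv_smul_mem_bidisc h1.1 h2 h3))
    refine (hd.congr_of_eventuallyEq ?_).differentiableWithinAt
    filter_upwards [(isOpen_lt continuous_fst.norm continuous_const).mem_nhds h2,
      (isOpen_lt continuous_snd.norm continuous_const).mem_nhds h3] with z hz1 hz2
    exact key' _ h1 z hz1 hz2
  · obtain ⟨K, hK, hbound⟩ := exists_lintegral_biHerglotz_le hp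
    refine (iSup₂_le fun ρ hρ => ?_).trans_lt (ENNReal.mul_lt_top hK.lt_top hfin)
    obtain ⟨r, hρr, hr1⟩ := exists_between hρ.2
    have hr : r ∈ Ioo (0 : ℝ) 1 := ⟨hρ.1.trans hρr, hr1⟩
    have hle : ∫⁻ s, ‖onTorus v r r s‖ₑ ^ p ≤ hardyNormPow p v :=
      le_iSup₂ (f := fun (r : ℝ) (_ : r ∈ Ioo (0 : ℝ) 1) => ∫⁻ t : Torus,
        ‖v ((r : ℂ) * circlePt t.1, (r : ℂ) * circlePt t.2)‖ₑ ^ p) r hr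
    have h := hbound _ (hv.continuous_onTorus hr hr).measurable (hle.trans_lt hfin) (ρ / r)
      (div_nonneg hρ.1.le hr.1.le) ((div_lt_one hr.1).2 hρr)
    refine le_trans (le_of_eq ?_) (h.trans (by gcongr))
    refine lintegral_congr fun t => ?_
    rw [key' r hr _ (by rwa [norm_ofReal_mul_circlePt hρ.1.le])
      (by rwa [norm_ofReal_mul_circlePt hρ.1.le])]
    congr 3
    simp only [Prod.smul_mk, smul_eq_mul, ofReal_div]
    congr 1 <;> ring

theorem IsSepHarmonic.biPoisson_onTorus {v : ℂ × ℂ → ℂ} (hv : IsSepHarmonic v) {r : ℝ}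
    (hr : r ∈ Ioo (0 : ℝ) 1) {z : ℂ × ℂ} (hz : z ∈ bidisc) :
    biPoisson (onTorus v r r) z = v ((r : ℂ) • z) := by
  have hz' := mem_bidisc.1 hz
  have hP : ∀ w : ℂ, ‖w‖ < 1 → Continuous fun s => (poissonK w s : ℂ) := fun w hw => by
    simp only [← halfHerglotz_add_conj]
    exact (continuous_halfHerglotz hw).add (continuous_conj.comp (continuous_halfHerglotz hw))
  rw [biPoisson, Measure.volume_eq_prod, integral_prod_symm]
  · calc _ = ∫ s₂, (poissonK z.2 s₂ : ℂ) *
          ∫ s₁, (poissonK z.1 s₁ : ℂ) * v (r * circlePt s₁, r * circlePt s₂) := by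
          congr 1
          ext s₂
          rw [← integral_const_mul]
          congr 1
          ext s₁
          rw [onTorus]
          ring
      _ = ∫ s₂, (poissonK z.2 s₂ : ℂ) * v (r * z.1, r * circlePt s₂) := by
          congr 1
          ext s₂
          congr 1
          exact integral_poissonK_mul_harmonic (hv.fst _ (circle_mem_ball hr s₂)) hr.1 hr.2 hz'.1
      _ = _ := by
          refine integral_poissonK_mul_harmonic (w := fun w => v (r * z.1, w))
            (hv.snd _ ?_) hr.1 hr.2 hz'.2
          rw [mem_ball_zero_iff, norm_mul, norm_real, Real.norm_of_nonneg hr.1.le]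
          nlinarith [hr.1, hr.2, hz'.1, norm_nonneg z.1]
  · exact integrable_of_continuous ((((hP _ hz'.1).comp continuous_fst).mul
      ((hP _ hz'.2).comp continuous_snd)).mul (hv.continuous_onTorus hr hr))

theorem hardyNormPow_conj (p : ℝ) (v : ℂ × ℂ → ℂ) :
    hardyNormPow p (fun z => conj (v z)) = hardyNormPow p v := by
  have hconj : ∀ w : ℂ, ‖conj w‖ₑ = ‖w‖ₑ := fun w => by
    rw [← ofReal_norm, RCLike.norm_conj, ofReal_norm]
  simp only [hardyNormPow, hconj]

theorem onTorus_negFst (v : ℂ × ℂ → ℂ) (r : ℝ) (s : Torus) :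
    onTorus v r r (negFst s) = onTorus (fun z => v (conjFst z)) r r s := by
  simp [onTorus, negFst, conjFst]

theorem hardyNormPow_comp_conjFst (p : ℝ) (v : ℂ × ℂ → ℂ) :
    hardyNormPow p (fun z => v (conjFst z)) = hardyNormPow p v := by
  refine iSup_congr fun r => iSup_congr fun _ => ?_
  have h := lintegral_comp_negFst fun s => ‖onTorus v r r s‖ₑ ^ p
  simp only [onTorus_negFst] at h
  exact h

theorem isHarmCarleson {p : ℝ} (hp : 1 < p) {μ : Measure (Disc × Disc)}
    (hμ : IsHolCarleson p μ) (hσμ : IsHolCarleson p (μ.map sigma)) : IsHarmCarleson p μ := by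
  rintro u ⟨hsm, h1, h2, hfin⟩
  have hu : IsSepHarmonic u := ⟨hsm.continuousOn, h1, h2⟩
  obtain ⟨f₁, hf₁, e₁⟩ := hu.exists_memHolHardy hp hfin
  obtain ⟨f₂, hf₂, e₂⟩ := hu.comp_conjFst.exists_memHolHardy hp
    (by rwa [hardyNormPow_comp_conjFst])
  obtain ⟨f₃, hf₃, e₃⟩ := hu.comp_conjFst.conj.exists_memHolHardy hp
    (by rwa [hardyNormPow_conj, hardyNormPow_comp_conjFst])
  obtain ⟨f₄, hf₄, e₄⟩ := hu.conj.exists_memHolHardy hp (by rwa [hardyNormPow_conj])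
  refine memLpBidisc_of_eq hμ hσμ hf₁ hf₂ hf₃ hf₄ fun z hz => ?_
  have hz' := mem_bidisc.1 hz
  obtain ⟨r, hr, hr1⟩ := exists_between (max_lt hz'.1 hz'.2)
  rw [max_lt_iff] at hr
  have hrm : r ∈ Ioo (0 : ℝ) 1 := ⟨(norm_nonneg _).trans_lt hr.1, hr1⟩
  have hr0 : (r : ℂ) ≠ 0 := by exact_mod_cast hrm.1.ne'
  obtain ⟨w, hw, rfl⟩ : ∃ w ∈ bidisc, z = (r : ℂ) • w :=
    ⟨_, inv_smul_mem_bidisc hrm.1 hr.1 hr.2, (smul_inv_smul₀ hr0 z).symm⟩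
  have hcw := conjFst_mem_bidisc hw
  have hcz : conjFst ((r : ℂ) • w) = (r : ℂ) • conjFst w := by simp [conjFst]
  have hP := biPoisson_eq (integrable_of_continuous (hu.continuous_onTorus hrm hrm)) hw
  rw [hu.biPoisson_onTorus hrm hw] at hP
  rw [hcz, hP, ← e₁ r hrm _ hw, ← e₂ r hrm _ hcw, ← e₃ r hrm _ hcw, ← e₄ r hrm _ hw]
  simp only [onTorus_negFst]
  rfl

/-! ### The Chang–Stein condition -/

theorem norm_circlePt_sub_le (x y : ℝ) :
    ‖circlePt (y : UnitAddCircle) - circlePt (x : UnitAddCircle)‖ ≤ 2 * Real.pi * |y - x| := by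
  have h : circlePt (y : UnitAddCircle) - circlePt (x : UnitAddCircle) =
      circlePt (x : UnitAddCircle) * (exp (I * ((2 * Real.pi * (y - x) : ℝ) : ℂ)) - 1) := by
    rw [circlePt_coe, circlePt_coe, mul_sub, ← exp_add, mul_one]
    congr 2
    push_cast
    ring
  rw [h, norm_mul, norm_circlePt, one_mul]
  refine (Real.norm_exp_I_mul_ofReal_sub_one_le).trans_eq ?_
  rw [Real.norm_eq_abs, abs_mul, abs_of_pos Real.two_pi_pos]

theorem exists_coe_of_mem_closedBall {c ε : ℝ} {s : UnitAddCircle}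
    (hs : s ∈ closedBall (c : UnitAddCircle) ε) :
    ∃ y : ℝ, (y : UnitAddCircle) = s ∧ |y - c| ≤ ε := by
  obtain ⟨y, rfl⟩ := QuotientAddGroup.mk_surjective s
  rw [mem_closedBall, dist_eq_norm] at hs
  have hs' : ‖((y - c : ℝ) : UnitAddCircle)‖ ≤ ε := hs
  rw [UnitAddCircle.norm_eq] at hs'
  refine ⟨y - round (y - c), ?_, ?_⟩
  · rw [AddCircle.coe_sub]
    have : ((round (y - c) : ℝ) : UnitAddCircle) = 0 := by
      simp
    rw [this, sub_zero]
  · rwa [sub_right_comm]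

/-- Near its top, the Carleson region of an arc sees a large part of the arc. The smaller arc is
adjacent to `z / |z|`, on a side on which `I` extends far enough. -/
theorem exists_subset_of_mem_carlesonRegion {I : Set UnitAddCircle} (hI : IsArc I) {z : Disc}
    (hz : z ∈ carlesonRegion I) :
    ∃ B ⊆ I, MeasurableSet B ∧ volume.real B = (1 - ‖(z : ℂ)‖) / 4 ∧
      ∀ s ∈ B, 1 / (9 * (1 - ‖(z : ℂ)‖)) ≤ poissonK z s := by
  obtain ⟨J, hJ, rfl⟩ := hI
  obtain ⟨hz0, hvol, i, ⟨x, hxJ, rfl⟩, hx⟩ := hz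
  have hz1 : ‖(z : ℂ)‖ < 1 := mem_ball_zero_iff.1 z.2
  have hzpos : 0 < ‖(z : ℂ)‖ := norm_pos_iff.2 hz0
  set δ := 1 - ‖(z : ℂ)‖ with hδ
  have hδ0 : 0 < δ := by linarith
  have hzx : (z : ℂ) = ‖(z : ℂ)‖ * circlePt (x : UnitAddCircle) := by
    have : (‖(z : ℂ)‖ : ℂ) ≠ 0 := by exact_mod_cast hzpos.ne'
    dsimp only at hx
    rw [hx]
    field_simp
  have hP : ∀ y : ℝ, |y - x| ≤ δ / 4 → 1 / (9 * δ) ≤ poissonK z (y : UnitAddCircle) := by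
    intro y hy
    have h1 : ‖circlePt (y : UnitAddCircle) - z‖ ≤ 3 * δ := by
      calc ‖circlePt (y : UnitAddCircle) - z‖
          ≤ ‖circlePt (y : UnitAddCircle) - circlePt (x : UnitAddCircle)‖ +
            ‖circlePt (x : UnitAddCircle) - z‖ := norm_sub_le_norm_sub_add_norm_sub _ _ _
        _ ≤ 2 * Real.pi * |y - x| + δ := by
            refine add_le_add (norm_circlePt_sub_le x y) (le_of_eq ?_)
            have : circlePt (x : UnitAddCircle) - z = (δ : ℂ) * circlePt (x : UnitAddCircle) := by
              rw [hδ]; push_cast; linear_combination -hzx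
            rw [this, norm_ofReal_mul_circlePt hδ0.le]
        _ ≤ 2 * 4 * (δ / 4) + δ := by
            gcongr
            exact Real.pi_le_four
        _ = 3 * δ := by ring
    have h2 : 0 < ‖circlePt (y : UnitAddCircle) - z‖ :=
      norm_pos_iff.2 (circlePt_sub_ne_zero hz1 _)
    have h3 : ‖circlePt (y : UnitAddCircle) - z‖ ^ 2 ≤ (3 * δ) ^ 2 := by gcongr
    rw [poissonK, div_le_div_iff₀ (by positivity) (by positivity)]
    have h4 : δ ≤ 1 - ‖(z : ℂ)‖ ^ 2 := by nlinarith
    nlinarith [mul_le_mul_of_nonneg_right h4 (by positivity : 0 ≤ 9 * δ)]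
  have hball : ∀ c : ℝ, (∀ y, |y - c| ≤ δ / 8 → y ∈ J ∧ |y - x| ≤ δ / 4) →
      ∃ B ⊆ (fun x : ℝ => (x : UnitAddCircle)) '' J, MeasurableSet B ∧
        volume.real B = δ / 4 ∧ ∀ s ∈ B, 1 / (9 * δ) ≤ poissonK z s := by
    intro c hc
    refine ⟨closedBall (c : UnitAddCircle) (δ / 8), fun s hs => ?_, measurableSet_closedBall, ?_,
      fun s hs => ?_⟩
    · obtain ⟨y, rfl, hy⟩ := exists_coe_of_mem_closedBall hs
      exact ⟨y, (hc y hy).1, rfl⟩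
    · rw [measureReal_def, AddCircle.volume_closedBall, ENNReal.toReal_ofReal, min_eq_right] <;>
        first | linarith | (refine le_min ?_ ?_ <;> linarith)
    · obtain ⟨y, rfl, hy⟩ := exists_coe_of_mem_closedBall hs
      exact hP y (hc y hy).2
  by_cases h1 : x + δ / 4 ∈ J
  · refine hball (x + δ / 8) fun y hy => ?_
    rw [abs_le] at hy
    refine ⟨hJ.out hxJ h1 ⟨by linarith, by linarith⟩, abs_le.2 ⟨by linarith, by linarith⟩⟩
  by_cases h2 : x - δ / 4 ∈ J
  · refine hball (x - δ / 8) fun y hy => ?_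
    rw [abs_le] at hy
    refine ⟨hJ.out h2 hxJ ⟨by linarith, by linarith⟩, abs_le.2 ⟨by linarith, by linarith⟩⟩
  -- Otherwise the arc would be shorter than `δ`.
  exfalso
  have hsub : (fun x : ℝ => (x : UnitAddCircle)) '' J ⊆ closedBall (x : UnitAddCircle) (δ / 4) := by
    rintro _ ⟨y, hy, rfl⟩
    have hy1 : y ≤ x + δ / 4 := by
      by_contra! h
      exact h1 (hJ.out hxJ hy ⟨by linarith, h.le⟩)
    have hy2 : x - δ / 4 ≤ y := by
      by_contra! h
      exact h2 (hJ.out hy hxJ ⟨h.le, by linarith⟩)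
    rw [mem_closedBall, dist_eq_norm]
    have h3 : ‖((y - x : ℝ) : UnitAddCircle)‖ ≤ |y - x| := by
      rw [UnitAddCircle.norm_eq]
      simpa using round_le (y - x) 0
    exact h3.trans (abs_le.2 ⟨by linarith, by linarith⟩)
  have h3 := hvol.trans (measure_mono hsub)
  rw [AddCircle.volume_closedBall, ENNReal.ofReal_le_ofReal_iff (le_min (by linarith)
    (by linarith)), le_min_iff] at h3
  linarith [h3.2]

/-- Poisson integrals of functions that are at least `a` on `U` are bounded below on the tent over
`U`: in each variable, the kernel is at least `1 / (9 δ)` on a set of measure `δ / 4`. -/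
theorem le_norm_biPoisson_of_mem_carlesonTent {U : Set Torus} {g : Torus → ℝ}
    (hg0 : ∀ s, 0 ≤ g s) (hg : Integrable g) {a : ℝ} (ha : 0 ≤ a)
    (hU : ∀ᵐ s, s ∈ U → a ≤ g s) {z : Disc × Disc} (hz : z ∈ carlesonTent U) :
    a / 36 ^ 2 ≤ ‖biPoisson (fun s => (g s : ℂ)) (z.1, z.2)‖ := by
  obtain ⟨I₁, I₂, hI₁, hI₂, hsub, hz₁, hz₂⟩ := hz
  obtain ⟨B₁, hB₁, hm₁, hv₁, hP₁⟩ := exists_subset_of_mem_carlesonRegion hI₁ hz₁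
  obtain ⟨B₂, hB₂, hm₂, hv₂, hP₂⟩ := exists_subset_of_mem_carlesonRegion hI₂ hz₂
  have hz1 : ‖(z.1 : ℂ)‖ < 1 := mem_ball_zero_iff.1 z.1.2
  have hz2 : ‖(z.2 : ℂ)‖ < 1 := mem_ball_zero_iff.1 z.2.2
  set δ₁ := 1 - ‖(z.1 : ℂ)‖ with hδ₁
  set δ₂ := 1 - ‖(z.2 : ℂ)‖ with hδ₂
  have h1 : 0 < δ₁ := by linarith
  have h2 : 0 < δ₂ := by linarith
  have hreal : biPoisson (fun s => (g s : ℂ)) (z.1, z.2) =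
      ((∫ s : Torus, poissonK z.1 s.1 * poissonK z.2 s.2 * g s : ℝ) : ℂ) := by
    rw [biPoisson, ← integral_complex_ofReal]
    simp only [ofReal_mul]
  have hcP : ∀ w : ℂ, ‖w‖ < 1 → Continuous (poissonK w) := fun w hw => by
    have := continuous_re.comp (continuous_halfHerglotz hw)
    have h3 : poissonK w = fun s => 2 * (halfHerglotz w s).re :=
      funext fun s => (two_mul_re_halfHerglotz w s).symm
    rw [h3]
    exact continuous_const.mul this
  have hc : Continuous fun s : Torus => poissonK z.1 s.1 * poissonK z.2 s.2 :=
    ((hcP _ hz1).comp continuous_fst).mul ((hcP _ hz2).comp continuous_snd)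
  have hint : Integrable fun s : Torus => poissonK z.1 s.1 * poissonK z.2 s.2 * g s := by
    obtain ⟨C, hC⟩ := isCompact_univ.exists_bound_of_continuousOn hc.continuousOn
    exact hg.bdd_mul hc.aestronglyMeasurable (ae_of_all _ fun x => hC x (mem_univ x))
  rw [hreal, norm_real]
  refine le_trans ?_ (le_abs_self _)
  have hm := hm₁.prod hm₂
  calc a / 36 ^ 2 = ∫ s : Torus, (B₁ ×ˢ B₂).indicator
        (fun _ => 1 / (9 * δ₁) * (1 / (9 * δ₂)) * a) s := by
        rw [integral_indicator_const _ hm, Measure.volume_eq_prod, measureReal_prod_prod, hv₁, hv₂,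
          smul_eq_mul]
        field_simp
        ring
    _ ≤ _ := by
        refine integral_mono_ae ((integrable_const _).indicator hm) hint ?_
        filter_upwards [hU] with s hs
        by_cases hsB : s ∈ B₁ ×ˢ B₂
        · rw [indicator_of_mem hsB]
          have h3 := hP₁ _ hsB.1
          have h4 := hP₂ _ hsB.2
          have h5 := hs (hsub ⟨hB₁ hsB.1, hB₂ hsB.2⟩)
          have h6 := (poissonK_pos hz1 s.1).le
          have h7 := (poissonK_pos hz2 s.2).le
          gcongr
        · rw [indicator_of_notMem hsB]
          exact mul_nonneg (mul_nonneg (poissonK_pos hz1 s.1).le (poissonK_pos hz2 s.2).le)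
            (hg0 s)

theorem carlesonTent_empty : carlesonTent ∅ = ∅ := by
  rw [eq_empty_iff_forall_notMem]
  rintro z ⟨I₁, I₂, -, -, hsub, ⟨-, -, i, hi, -⟩, ⟨-, -, j, hj, -⟩⟩
  exact hsub (mk_mem_prod hi hj)

/-- If the Chang–Stein condition failed, with constants `4 ^ n` on open sets `U n`, the Poisson
integral of `(∑ 2⁻ⁿ |U n|⁻¹ 1_{U n}) ^ (1 / p)` would not be in `L ^ p (μ)`. -/
theorem changStein {p : ℝ} (hp : 1 < p) {μ : Measure (Disc × Disc)}
    (hμ : IsHolCarleson p μ) (hσμ : IsHolCarleson p (μ.map sigma)) : ChangStein μ := by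
  by_contra hcon
  have hp0 : 0 < p := by linarith
  have hex : ∀ n : ℕ, ∃ U : Set Torus, IsOpen U ∧
      ENNReal.ofReal (4 ^ n) * volume U < μ (carlesonTent U) := by
    intro n
    by_contra! h
    exact hcon ⟨4 ^ n, by positivity, h⟩
  choose U hUo hU using hex
  have hU0 : ∀ n, volume (U n) ≠ 0 := by
    intro n h0
    have := hU n
    rw [((hUo n).measure_eq_zero_iff volume).1 h0, carlesonTent_empty] at this
    simp at this
  have hUt : ∀ n, volume (U n) ≠ ∞ := fun n => measure_ne_top _ _
  set b : ℕ → ℝ≥0∞ := fun n => 2⁻¹ ^ n / volume (U n) with hb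
  have hbt : ∀ n, b n ≠ ∞ := fun n => ENNReal.div_ne_top (by simp) (hU0 n)
  have hbU : ∀ n, b n * volume (U n) = 2⁻¹ ^ n := fun n =>
    ENNReal.div_mul_cancel (hU0 n) (hUt n)
  set G : Torus → ℝ≥0∞ := fun s => ∑' n, (U n).indicator (fun _ => b n) s with hG
  have hGm : Measurable G := Measurable.tsum fun n =>
    measurable_const.indicator (hUo n).measurableSet
  have hGint : ∫⁻ s, G s < ∞ := by
    rw [hG, lintegral_tsum fun n => (measurable_const.indicator (hUo n).measurableSet).aemeasurable]
    simp_rw [lintegral_indicator_const (hUo _).measurableSet, hbU]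
    rw [ENNReal.tsum_geometric]
    simp
  set g : Torus → ℝ := fun s => (G s ^ (1 / p)).toReal with hg
  have hgm : Measurable g := (hGm.pow_const _).ennreal_toReal
  have hgfin : ∫⁻ s, ‖g s‖ₑ ^ p < ∞ := by
    refine (lintegral_mono fun s => ?_).trans_lt hGint
    rw [Real.enorm_eq_ofReal ENNReal.toReal_nonneg]
    calc ENNReal.ofReal (G s ^ (1 / p)).toReal ^ p ≤ (G s ^ (1 / p)) ^ p := by
          gcongr
          exact ENNReal.ofReal_toReal_le
      _ = G s := by rw [← ENNReal.rpow_mul, one_div_mul_cancel hp0.ne', ENNReal.rpow_one]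
  have hgi : Integrable g := integrable_of_lintegral_rpow_lt_top hp hgm.aestronglyMeasurable hgfin
  have hmem := memLpBidisc_biPoisson hp hμ hσμ (g := fun s => (g s : ℂ))
    (measurable_ofReal.comp hgm) (by
      have : ∀ x : ℝ, ‖(x : ℂ)‖ₑ = ‖x‖ₑ := fun x => by
        rw [← ofReal_norm, norm_real, ofReal_norm]
      simpa only [this] using hgfin)
  have hX := lintegral_rpow_enorm_lt_top_of_eLpNorm_lt_top (by simpa using hp0)
    ENNReal.ofReal_ne_top hmem.2
  rw [ENNReal.toReal_ofReal hp0.le] at hX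
  set X := ∫⁻ z : Disc × Disc, ‖biPoisson (fun s => (g s : ℂ)) (z.1, z.2)‖ₑ ^ p ∂μ with hXdef
  set c : ℝ≥0∞ := ENNReal.ofReal (1 / 36 ^ 2) ^ p with hc
  have hc0 : c ≠ 0 := (ENNReal.rpow_pos (by simp) ENNReal.ofReal_ne_top).ne'
  have hct : c ≠ ∞ := ENNReal.rpow_ne_top_of_nonneg hp0.le ENNReal.ofReal_ne_top
  have hmain : ∀ n : ℕ, c * 2 ^ n ≤ X := by
    intro n
    have ha : ∀ᵐ s, s ∈ U n → (b n ^ (1 / p)).toReal ≤ g s := by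
      filter_upwards [ae_lt_top hGm hGint.ne] with s hs hsU
      refine ENNReal.toReal_mono (ENNReal.rpow_ne_top_of_nonneg (by positivity) hs.ne) ?_
      gcongr
      refine le_trans (le_of_eq ?_) (ENNReal.le_tsum n)
      rw [indicator_of_mem hsU]
    have hlow : carlesonTent (U n) ⊆ {z : Disc × Disc |
        c * b n ≤ ‖biPoisson (fun s => (g s : ℂ)) (z.1, z.2)‖ₑ ^ p} := by
      intro z hz
      have h1 := le_norm_biPoisson_of_mem_carlesonTent (fun _ => ENNReal.toReal_nonneg) hgi
        ENNReal.toReal_nonneg ha hz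
      have h2 : c * b n = ENNReal.ofReal ((b n ^ (1 / p)).toReal / 36 ^ 2) ^ p := by
        rw [div_eq_mul_one_div, ENNReal.ofReal_mul ENNReal.toReal_nonneg,
          ENNReal.ofReal_toReal (ENNReal.rpow_ne_top_of_nonneg (by positivity) (hbt n)),
          ENNReal.mul_rpow_of_nonneg _ _ hp0.le, ← ENNReal.rpow_mul, one_div_mul_cancel hp0.ne',
          ENNReal.rpow_one, mul_comm]
      rw [mem_ofPred_eq, h2, ← ofReal_norm]
      gcongr
    have hcheb := mul_meas_ge_le_lintegral₀ (hmem.1.aemeasurable.enorm.pow_const p) (c * b n)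
    calc c * 2 ^ n = c * b n * (ENNReal.ofReal (4 ^ n) * volume (U n)) := by
          rw [mul_assoc, mul_left_comm (b n), hbU, ENNReal.ofReal_pow (by norm_num), ← mul_pow]
          congr 2
          rw [show (4 : ℝ) = 2 * 2 by norm_num, ENNReal.ofReal_mul (by norm_num), mul_assoc,
            ENNReal.ofReal_ofNat, ENNReal.mul_inv_cancel (by simp) (by simp), mul_one]
      _ ≤ c * b n * μ (carlesonTent (U n)) := by gcongr; exact (hU n).le
      _ ≤ c * b n * μ _ := by gcongr
      _ ≤ X := hcheb
  obtain ⟨n, hn⟩ := ENNReal.exists_nat_gt (ENNReal.div_ne_top hX.ne hc0)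
  have h1 : (n : ℝ≥0∞) ≤ 2 ^ n := by exact_mod_cast (Nat.lt_two_pow_self (n := n)).le
  have h2 := hmain n
  rw [mul_comm, ← ENNReal.le_div_iff_mul_le (Or.inl hc0) (Or.inl hct)] at h2
  exact absurd (hn.trans_le (h1.trans h2)) (lt_irrefl _)

end

end BidiscHardy

theorem lemma3p2 (p : ℝ) (hp : 1 < p)
    (μ : MeasureTheory.Measure (BidiscHardy.Disc × BidiscHardy.Disc))
    (hμ : BidiscHardy.IsHolCarleson p μ)
    (hσμ : BidiscHardy.IsHolCarleson p (μ.map BidiscHardy.sigma)) :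
    BidiscHardy.IsHarmCarleson p μ ∧ BidiscHardy.ChangStein μ :=
  ⟨BidiscHardy.isHarmCarleson hp hμ hσμ, BidiscHardy.changStein hp hμ hσμ⟩
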